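/- An instance of \textsc{Maximum Envy-Free Assignment} consists of $n$ agents $a_1,\dots,a_n$, $m \ge n$ houses $h_1,\dots,h_m$, and a non-negative rational utility $u_a(h)$ for every agent $a$ and every house $h$. An \emph{assignment} is an injection $\phi$ from the set $A$ of agents to the set of houses; an agent $a$ is \emph{envy-free} in $\phi$ if $u_a(\phi(a)) \ge u_a(\phi(a'))$ for all $a' \in A$, and $\mathrm{val}(\phi)$ denotes the number of envy-free agents in $\phi$. The goal is to find an assignment that maximizes $\mathrm{val}(\phi)$. An instance of \textsc{Maximum Balanced Biclique} is a finite bipartite graph $G=(L,R,E)$. A \emph{balanced biclique} of $G$ is a pair $S \subseteq L$, $T \subseteq R$ with $|S|=|T|$ and $S \times T \subseteq E$ (the empty pair is allowed); $p=|S|$ is its size. The goal is to find a balanced biclique of maximum size $\mathrm{opt}_{\mathrm{MBB}}(G)$. Write $N=|L|$. For a function $f:\mathbb{N}\to\mathbb{R}$, a polynomial-time $f(n)$-approximation algorithm for \textsc{Maximum Envy-Free Assignment} is a deterministic algorithm (a Turing machine) that, on every instance, outputs within a number of steps polynomial in the length of the encoded instance an assignment $\phi$ such that $\max_{\phi'}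 \mathrm{val}(\phi') \le f(n)\cdot \mathrm{val}(\phi)$, where $n$ is the number of agents. For $g:\mathbb{N}\to\mathbb{R}$, a polynomial-time $g(N)$-approximation algorithm for \textsc{Maximum Balanced Biclique} is likewise one that outputs in polynomial time, on every bipartite graph $G$, a balanced biclique $(S,T)$ of $G$ with $\mathrm{opt}_{\mathrm{MBB}}(G) \le g(N)\cdot |S|$. Rational numbers are encoded by numerator and denominator in binary, and the lists of agents, of houses and of vertices are part of the encoded instance. \textbf{Theorem.} For every constant $\varepsilon > 0$ and every function $f:\mathbb{N}\to\mathbb{R}$, if there exists a polynomial-time $f(n)$-approximation algorithm for \textsc{Maximum Envy-Free Assignment}, then there exists a polynomial-time $2(1+\varepsilon)\cdot f(N)$-approximation algorithm for \textsc{Maximum Balanced Biclique}. -/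

import Mathlib

open scoped NNRat

/-- The row-major listing of an `n × m` table of words; every row is closed by the symbol `ket`. -/
def encodeTable {n m : ℕ} (w : Fin n → Fin m → List Computability.Γ') : List Computability.Γ' :=
  (List.finRange n).flatMap fun i => (List.finRange m).flatMap (w i) ++ [Computability.Γ'.ket]

/-- The number `k` in unary, closed by a comma. -/
def encodeUnary (k : ℕ) : List Computability.Γ' :=
  List.replicate k (Computability.Γ'.bit true) ++ [Computability.Γ'.comma]

/-- The number `k` in binary (least significant bit first), closed by a comma. -/
def encodeBinary (k : ℕ) : List Computability.Γ' :=
  k.bits.map Computability.Γ'.bit ++ [Computability.Γ'.comma]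

/-- A non-negative rational number: numerator and denominator (in lowest terms), both in binary. -/
def encodeNNRat (q : ℚ≥0) : List Computability.Γ' :=
  encodeBinary q.num ++ encodeBinary q.den

/-! ### Maximum Envy-Free Assignment -/

/-- An instance of house allocation: `n` agents, `m ≥ n` houses, and the non-negative
(rational) utility of every agent for every house. -/
structure HouseInstance where
  /-- number of agents -/
  n : ℕ
  /-- number of houses -/
  m : ℕ
  n_le_m : n ≤ m
  /-- `u a h` is the utility of agent `a` for house `h` -/
  u : Fin n → Fin m → ℚ≥0

namespace HouseInstance

variable (I : HouseInstance)

/-- An assignment is an injection from the agents to the houses. -/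
abbrev Assignment : Type := Fin I.n ↪ Fin I.m

/-- Agent `a` is envy-free in the assignment `φ`. -/
def IsEnvyFree (φ : I.Assignment) (a : Fin I.n) : Prop :=
  ∀ a' : Fin I.n, I.u a (φ a') ≤ I.u a (φ a)

instance (φ : I.Assignment) : DecidablePred (I.IsEnvyFree φ) := fun a =>
  inferInstanceAs (Decidable (∀ a' : Fin I.n, I.u a (φ a') ≤ I.u a (φ a)))

/-- The number of envy-free agents in the assignment `φ`. -/
def val (φ : I.Assignment) : ℕ := (Finset.univ.filter (I.IsEnvyFree φ)).card

/-- The largest number of envy-free agents in an assignment. -/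
noncomputable def opt : ℕ := (Finset.univ : Finset I.Assignment).sup I.val

/-- An instance as a word: the two numbers `n` and `m` in unary (that is, a list of the agents and
a list of the houses), then the table of the utilities. -/
def encode : List Computability.Γ' :=
  encodeUnary I.n ++ encodeUnary I.m ++ encodeTable fun a h => encodeNNRat (I.u a h)

/-- An assignment as a word: its `0/1`-matrix. -/
def encodeAssignment (φ : I.Assignment) : List Computability.Γ' :=
  encodeTable fun a h => [Computability.Γ'.bit (decide (φ a = h))]

end HouseInstance

/-- There is a (deterministic) polynomial-time algorithm that computes, for every instance with `n`
agents, an assignment whose number of envy-free agents is at least the maximum divided by `f n`. -/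
def HasPolyTimeEnvyFreeApprox (f : ℕ → ℝ) : Prop :=
  ∃ alg : (I : HouseInstance) → I.Assignment,
    Nonempty (Turing.TM2ComputableInPolyTime HouseInstance.encode
      (id : List Computability.Γ' → List Computability.Γ')
      (fun I => I.encodeAssignment (alg I))) ∧
    ∀ I : HouseInstance, (I.opt : ℝ) ≤ f I.n * (I.val (alg I) : ℝ)

/-! ### Maximum Balanced Biclique -/

/-- A bipartite graph with `N` left vertices, `M` right vertices, and edge set `E`. -/
structure BipartiteInstance where
  /-- number of left vertices -/
  N : ℕ
  /-- number of right vertices -/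
  M : ℕ
  /-- the edges -/
  E : Finset (Fin N × Fin M)

namespace BipartiteInstance

variable (G : BipartiteInstance)

/-- `S` and `T` are the two sides of a balanced biclique of `G`. -/
def IsBalancedBiclique (S : Finset (Fin G.N)) (T : Finset (Fin G.M)) : Prop :=
  S.card = T.card ∧ ∀ b ∈ S, ∀ c ∈ T, (b, c) ∈ G.E

instance (S : Finset (Fin G.N)) (T : Finset (Fin G.M)) : Decidable (G.IsBalancedBiclique S T) :=
  inferInstanceAs (Decidable (S.card = T.card ∧ ∀ b ∈ S, ∀ c ∈ T, (b, c) ∈ G.E))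

/-- A balanced biclique of `G` (possibly empty). -/
structure BalancedBiclique where
  /-- left side -/
  S : Finset (Fin G.N)
  /-- right side -/
  T : Finset (Fin G.M)
  isBalancedBiclique : G.IsBalancedBiclique S T

/-- The largest `p` such that `G` contains a complete bipartite graph with `p` vertices
on each side. -/
def opt : ℕ :=
  ((Finset.univ : Finset (Finset (Fin G.N) × Finset (Fin G.M))).filter
    fun B => G.IsBalancedBiclique B.1 B.2).sup fun B => B.1.card

/-- A bipartite graph as a word: the two numbers of vertices in unary (that is, a list of the left
vertices and a list of the right vertices), then the adjacency matrix. -/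
def encode : List Computability.Γ' :=
  encodeUnary G.N ++ encodeUnary G.M ++
    encodeTable fun b c => [Computability.Γ'.bit (decide ((b, c) ∈ G.E))]

/-- A biclique as a word: the characteristic vectors of its two sides. -/
def encodeBiclique (B : G.BalancedBiclique) : List Computability.Γ' :=
  (List.finRange G.N).map (fun b => Computability.Γ'.bit (decide (b ∈ B.S))) ++
    [Computability.Γ'.comma] ++
    (List.finRange G.M).map (fun c => Computability.Γ'.bit (decide (c ∈ B.T)))

end BipartiteInstance

/-- There is a (deterministic) polynomial-time algorithm that computes, for every bipartite graph
with `N` left vertices, a balanced biclique whose size is at least the maximum divided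
by `g N`. -/
def HasPolyTimeBicliqueApprox (g : ℕ → ℝ) : Prop :=
  ∃ alg : (G : BipartiteInstance) → G.BalancedBiclique,
    Nonempty (Turing.TM2ComputableInPolyTime BipartiteInstance.encode
      (id : List Computability.Γ' → List Computability.Γ')
      (fun G => G.encodeBiclique (alg G))) ∧
    ∀ G : BipartiteInstance, (G.opt : ℝ) ≤ g G.N * ((alg G).S.card : ℝ)

/-! Fix an edge `(i₀, j₀)` of the graph and keep only the adjacencies between common neighbours of
its ends, with `i₀` and `j₀` themselves excluded (`AdjAvoid`). In the associated house instance the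
left vertices are agents, the right vertices are houses, and `N - 1` worthless houses are added. A
related house is worth `1`; an unrelated house `h` is worth `2 ^ (h + 1)`, so unrelated houses get
dearer along the order of the houses.

An envy-free agent holding `c` must be related to every held right vertex beyond `c`, since an
unrelated one would be worth more. The worthless houses are too few for all agents, so somebody
holds a right vertex, and envy-free agents hold right vertices too (`good_of_isEnvyFree`). Sort the
`k` houses held by agents of this kind: the holders of the first `⌊k/2⌋` are related to all of the
last `⌊k/2⌋` (`LeftHalf.rel`), and together with the edge they form a balanced biclique of size
`⌊k/2⌋ + 1`.

Conversely, a balanced biclique of size `p` through the edge yields an assignment with at least `p -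
1` envy-free agents (`le_opt_toHouse`). Take an edge inside an optimal biclique, and let `k` be the
largest count over all edges. Since `f ≥ 1` at positive arguments (`one_le_of_opt_le`), `p ≤ f k + 1
≤ f (k + 1) ≤ 2 f (⌊k/2⌋ + 1)`. The guessed edge absorbs the rounding loss, so the factor `2 f` is
already reached and `1 + ε` is slack.

The rest shows that trying all edges takes polynomial time on a Turing machine. Programs are
composed from fragments that work on registers and contain the given machine as a subroutine.
`PolyTime` says that some fragment pushes a word in polynomial time; it is closed under
concatenation, branching, bounded iteration and calls of the given algorithm (`PolyTime.oracle`).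
Unary numbers and predicates are special words, so the reduction can be written as a formula, and
`PolyTime.toTM2` turns it back into a machine. -/

open Turing Computability

/-! ### Program fragments -/

/-- `StepsTo M n c c'`: the program `M` goes from `c` to `c'` in exactly `n` steps. -/
inductive StepsTo {K : Type} [DecidableEq K] {Γ : K → Type} {Λ σ : Type}
    (M : Λ → TM2.Stmt Γ Λ σ) : ℕ → TM2.Cfg Γ Λ σ → TM2.Cfg Γ Λ σ → Prop
  | refl (c) : StepsTo M 0 c c
  | head {n c c' c''} : TM2.step M c = some c' → StepsTo M n c' c'' → StepsTo M (n + 1) c c''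

section StepsTo

variable {K : Type} [DecidableEq K] {Γ : K → Type} {Λ Λ' σ : Type}

theorem StepsTo.trans {M : Λ → TM2.Stmt Γ Λ σ} {n m : ℕ} {a b c : TM2.Cfg Γ Λ σ}
    (h₁ : StepsTo M n a b) (h₂ : StepsTo M m b c) : StepsTo M (n + m) a c := by
  induction h₁ with
  | refl => simpa using h₂
  | @head n _ _ _ h _ ih => rw [Nat.add_right_comm]; exact .head h (ih h₂)

theorem iterate_bind_none {α : Type} (f : α → Option α) (n : ℕ) :
    (flip bind f)^[n] none = none := by
  induction n with
  | zero => rfl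
  | succ n ih => rw [Function.iterate_succ_apply]; exact ih

theorem stepsTo_iff_iterate {M : Λ → TM2.Stmt Γ Λ σ} {n : ℕ} {a b : TM2.Cfg Γ Λ σ} :
    StepsTo M n a b ↔ (flip bind (TM2.step M))^[n] (some a) = some b := by
  constructor
  · intro h
    induction h with
    | refl => rfl
    | head h _ ih => rw [Function.iterate_succ_apply, ← ih, ← h]; rfl
  · intro h
    induction n generalizing a with
    | zero => cases h; exact .refl _
    | succ n ih =>
      rw [Function.iterate_succ_apply] at h
      change (flip bind (TM2.step M))^[n] (TM2.step M a) = some b at h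
      cases hs : TM2.step M a with
      | none => rw [hs, iterate_bind_none] at h; cases h
      | some c => rw [hs] at h; exact .head hs (ih h)

/-- Rename the labels of a statement, and continue with `ex` where it halts. -/
def TM2Stmt.relabel (g : Λ → Λ') (ex : TM2.Stmt Γ Λ' σ) : TM2.Stmt Γ Λ σ → TM2.Stmt Γ Λ' σ
  | .push k f q => .push k f (relabel g ex q)
  | .peek k f q => .peek k f (relabel g ex q)
  | .pop k f q => .pop k f (relabel g ex q)
  | .load a q => .load a (relabel g ex q)
  | .branch f q₁ q₂ => .branch f (relabel g ex q₁) (relabel g ex q₂)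
  | .goto f => .goto fun s => g (f s)
  | .halt => ex

theorem TM2Stmt.stepAux_relabel (g : Λ → Λ') (ex : TM2.Stmt Γ Λ' σ) (q : TM2.Stmt Γ Λ σ) (v : σ)
    (S : ∀ k, List (Γ k)) :
    TM2.stepAux (relabel g ex q) v S =
      match (TM2.stepAux q v S).l with
      | some l => ⟨some (g l), (TM2.stepAux q v S).var, (TM2.stepAux q v S).stk⟩
      | none => TM2.stepAux ex (TM2.stepAux q v S).var (TM2.stepAux q v S).stk := by
  induction q generalizing v S with
  | branch f q₁ q₂ ih₁ ih₂ =>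
    simp only [relabel, TM2.stepAux]
    cases f v
    · exact ih₂ _ _
    · exact ih₁ _ _
  | goto => rfl
  | halt => rfl
  | _ => simp only [relabel, TM2.stepAux, *]

/-- The continuation `ex` is executed inside the step that used to halt, so the number of steps
stays the same. Sequencing, branching and looping all rest on this. -/
theorem StepsTo.relabel {M : Λ → TM2.Stmt Γ Λ σ} {M' : Λ' → TM2.Stmt Γ Λ' σ} {g : Λ → Λ'}
    {ex : TM2.Stmt Γ Λ' σ} (hM : ∀ l, M' (g l) = TM2Stmt.relabel g ex (M l)) {n : ℕ} {l : Λ}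
    {v v' : σ} {S S' : ∀ k, List (Γ k)} (h : StepsTo M n ⟨some l, v, S⟩ ⟨none, v', S'⟩) :
    StepsTo M' n ⟨some (g l), v, S⟩ (TM2.stepAux ex v' S') := by
  induction n generalizing l v S with
  | zero => cases h
  | succ n ih =>
    cases h with
    | @head _ _ c' _ h h' =>
      have hc : TM2.stepAux (M l) v S = c' := by simpa [TM2.step] using h
      refine .head (c' := TM2.stepAux (M' (g l)) v S) (by simp [TM2.step]) ?_
      rw [hM, TM2Stmt.stepAux_relabel, hc]
      obtain ⟨_ | l', v₁, S₁⟩ := c'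
      · cases h' with
        | refl => exact .refl _
        | head h₁ _ => cases h₁
      · exact ih h'

end StepsTo

/-- A program with an entry label, to be used as a part of larger programs. -/
structure Frag {K : Type} (Γ : K → Type) (σ : Type) where
  /-- labels -/
  Λ : Type
  [fin : Fintype Λ]
  /-- entry label -/
  main : Λ
  /-- the statement at each label -/
  code : Λ → TM2.Stmt Γ Λ σ

attribute [instance] Frag.fin

/-! ### Composition of fragments: sequence, branch, loop -/

namespace Frag

variable {K : Type} [DecidableEq K] {Γ : K → Type} {σ : Type}

/-- Started with internal state `s`, the fragment halts within `t` steps with internal state `s`,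
and turns the stacks `S` into `S'`. -/
def Runs (F : Frag Γ σ) (s : σ) (t : ℕ) (S S' : ∀ k, List (Γ k)) : Prop :=
  ∃ n ≤ t, StepsTo F.code n ⟨some F.main, s, S⟩ ⟨none, s, S'⟩

theorem Runs.mono {F : Frag Γ σ} {s : σ} {t t' : ℕ} {S S' : ∀ k, List (Γ k)}
    (h : F.Runs s t S S') (ht : t ≤ t') : F.Runs s t' S S' :=
  let ⟨n, hn, h⟩ := h
  ⟨n, hn.trans ht, h⟩

/-- The fragment of a single statement. -/
def op (q : TM2.Stmt Γ Unit σ) : Frag Γ σ where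
  Λ := Unit
  main := ()
  code _ := q

theorem Runs.op {q : TM2.Stmt Γ Unit σ} {s : σ} {S S' : ∀ k, List (Γ k)}
    (h : TM2.stepAux q s S = ⟨none, s, S'⟩) : (op q).Runs s 1 S S' :=
  ⟨1, le_rfl, .head (by simp [TM2.step, Frag.op, h]) (.refl _)⟩

/-- Sequential composition. -/
def seq (F G : Frag Γ σ) : Frag Γ σ where
  Λ := F.Λ ⊕ G.Λ
  main := .inl F.main
  code
    | .inl l => TM2Stmt.relabel .inl (.goto fun _ => .inr G.main) (F.code l)
    | .inr l => TM2Stmt.relabel .inr .halt (G.code l)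

theorem Runs.seq {F G : Frag Γ σ} {s : σ} {t u : ℕ} {S S' S'' : ∀ k, List (Γ k)}
    (hF : F.Runs s t S S') (hG : G.Runs s u S' S'') : (F.seq G).Runs s (t + u) S S'' := by
  obtain ⟨n, hn, hF⟩ := hF
  obtain ⟨m, hm, hG⟩ := hG
  refine ⟨n + m, add_le_add hn hm, StepsTo.trans (b := ⟨some (.inr G.main), s, S'⟩) ?_ ?_⟩
  · exact hF.relabel (M' := (F.seq G).code) (g := .inl) (ex := .goto fun _ => .inr G.main)
      fun _ => rfl
  · exact hG.relabel (M' := (F.seq G).code) (g := .inr) (ex := .halt) fun _ => rfl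

open Classical in
/-- Continue with `q₁` if the top symbol of stack `k` satisfies `p`, and with `q₂` otherwise.
The internal state `s₁ ≠ s` is used as a flag. -/
noncomputable def test {Λ : Type} (s s₁ : σ) (k : K) (p : Option (Γ k) → Bool)
    (q₁ q₂ : TM2.Stmt Γ Λ σ) : TM2.Stmt Γ Λ σ :=
  .peek k (fun _ o => if p o then s₁ else s)
    (.branch (fun v => decide (v = s₁)) (.load (fun _ => s) q₁) (.load (fun _ => s) q₂))

/-- A branch statement sees only the internal state, so the outcome of the peek is passed through
the flag `s₁`; both branches restore `s` before going on. -/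
theorem stepAux_test {Λ : Type} {s s₁ : σ} (h : s₁ ≠ s) (k : K) (p : Option (Γ k) → Bool)
    (q₁ q₂ : TM2.Stmt Γ Λ σ) (v : σ) (S : ∀ k, List (Γ k)) :
    TM2.stepAux (test s s₁ k p q₁ q₂) v S =
      if p (S k).head? then TM2.stepAux q₁ s S else TM2.stepAux q₂ s S := by
  by_cases hp : p (S k).head? = true
  · simp [test, hp]
  · simp [test, hp, h.symm]

/-- Run `F` if the top symbol of stack `k` satisfies `p`, and `G` otherwise. -/
noncomputable def ite (s s₁ : σ) (k : K) (p : Option (Γ k) → Bool) (F G : Frag Γ σ) :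
    Frag Γ σ where
  Λ := Option (F.Λ ⊕ G.Λ)
  main := none
  code
    | none => test s s₁ k p (.goto fun _ => some (.inl F.main)) (.goto fun _ => some (.inr G.main))
    | some (.inl l) => TM2Stmt.relabel (fun l => some (.inl l)) .halt (F.code l)
    | some (.inr l) => TM2Stmt.relabel (fun l => some (.inr l)) .halt (G.code l)

theorem Runs.ite_true {F G : Frag Γ σ} {s s₁ : σ} (hs : s₁ ≠ s) {k : K} {p : Option (Γ k) → Bool}
    {t : ℕ} {S S' : ∀ k, List (Γ k)} (hp : p (S k).head? = true) (hF : F.Runs s t S S') :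
    (Frag.ite s s₁ k p F G).Runs s (t + 1) S S' := by
  obtain ⟨n, hn, hF⟩ := hF
  refine ⟨n + 1, by omega, .head (c' := ⟨some (some (.inl F.main)), s, S⟩) ?_ ?_⟩
  · simp [TM2.step, Frag.ite, stepAux_test hs, hp]
  · exact hF.relabel (M' := (Frag.ite s s₁ k p F G).code) (g := fun l => some (.inl l))
      (ex := .halt) fun _ => rfl

theorem Runs.ite_false {F G : Frag Γ σ} {s s₁ : σ} (hs : s₁ ≠ s) {k : K} {p : Option (Γ k) → Bool}
    {t : ℕ} {S S' : ∀ k, List (Γ k)} (hp : p (S k).head? = false) (hG : G.Runs s t S S') :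
    (Frag.ite s s₁ k p F G).Runs s (t + 1) S S' := by
  obtain ⟨n, hn, hG⟩ := hG
  refine ⟨n + 1, by omega, .head (c' := ⟨some (some (.inr G.main)), s, S⟩) ?_ ?_⟩
  · simp [TM2.step, Frag.ite, stepAux_test hs, hp]
  · exact hG.relabel (M' := (Frag.ite s s₁ k p F G).code) (g := fun l => some (.inr l))
      (ex := .halt) fun _ => rfl

/-- Run `F` as long as the top symbol of stack `k` satisfies `p`. -/
noncomputable def loop (s s₁ : σ) (k : K) (p : Option (Γ k) → Bool) (F : Frag Γ σ) : Frag Γ σ where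
  Λ := Option F.Λ
  main := none
  code
    | none => test s s₁ k p (.goto fun _ => some F.main) .halt
    | some l => TM2Stmt.relabel some (.goto fun _ => none) (F.code l)

theorem Runs.loop {F : Frag Γ σ} {s s₁ : σ} (hs : s₁ ≠ s) {k : K} {p : Option (Γ k) → Bool}
    {t n : ℕ} (S : ℕ → ∀ k, List (Γ k)) (hp : ∀ i < n, p (S i k).head? = true)
    (hF : ∀ i < n, F.Runs s t (S i) (S (i + 1))) (hn : p (S n k).head? = false) :
    (Frag.loop s s₁ k p F).Runs s (n * (t + 1) + 1) (S 0) (S n) := by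
  induction n generalizing S with
  | zero =>
    exact ⟨1, by omega, .head (by simp [TM2.step, Frag.loop, stepAux_test hs, hn]) (.refl _)⟩
  | succ n ih =>
    obtain ⟨m, hm, h⟩ := ih (fun i => S (i + 1)) (fun i hi => hp _ (by omega))
      (fun i hi => hF _ (by omega)) hn
    obtain ⟨l, hl, h'⟩ := hF 0 (by omega)
    refine ⟨(l + 1) + m, ?_, StepsTo.trans (b := ⟨some none, s, S 1⟩) ?_ h⟩
    · rw [Nat.succ_mul]; omega
    · refine .head (c' := ⟨some (some F.main), s, S 0⟩) ?_ ?_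
      · simp [TM2.step, Frag.loop, stepAux_test hs, hp 0 (by omega)]
      · exact h'.relabel (M' := (Frag.loop s s₁ k p F).code) (g := some)
          (ex := .goto fun _ => none) fun _ => rfl

end Frag

/-! ### Embedding a program into another machine -/

section Embed

variable {K K' : Type} {Γ : K → Type} {Γ' : K' → Type} {Λ σ σ' : Type}

/-- The statement only uses stacks in `U`. -/
def TM2Stmt.UsesIn (U : Set K) : TM2.Stmt Γ Λ σ → Prop
  | .push k _ q => k ∈ U ∧ UsesIn U q
  | .peek k _ q => k ∈ U ∧ UsesIn U q
  | .pop k _ q => k ∈ U ∧ UsesIn U q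
  | .load _ q => UsesIn U q
  | .branch _ q₁ q₂ => UsesIn U q₁ ∧ UsesIn U q₂
  | .goto _ => True
  | .halt => True

theorem TM2Stmt.UsesIn.mono {U V : Set K} (h : U ⊆ V) {q : TM2.Stmt Γ Λ σ}
    (hq : TM2Stmt.UsesIn U q) : TM2Stmt.UsesIn V q := by
  induction q with
  | push k _ q ih => exact ⟨h hq.1, ih hq.2⟩
  | peek k _ q ih => exact ⟨h hq.1, ih hq.2⟩
  | pop k _ q ih => exact ⟨h hq.1, ih hq.2⟩
  | load _ q ih => exact ih hq
  | branch _ q₁ q₂ ih₁ ih₂ => exact ⟨ih₁ hq.1, ih₂ hq.2⟩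
  | goto => trivial
  | halt => trivial

theorem TM2Stmt.usesIn_univ (q : TM2.Stmt Γ Λ σ) : TM2Stmt.UsesIn Set.univ q := by
  induction q <;> simp_all [TM2Stmt.UsesIn]

/-- Transport a statement along a map `r` of stacks, bijections `e` of stack alphabets, and an
embedding of internal states. -/
def TM2Stmt.embed (r : K → K') (e : ∀ k, Γ k ≃ Γ' (r k)) (get : σ' → σ) (put : σ → σ') :
    TM2.Stmt Γ Λ σ → TM2.Stmt Γ' Λ σ'
  | .push k f q => .push (r k) (fun s => e k (f (get s))) (embed r e get put q)
  | .peek k f q => .peek (r k) (fun s o => put (f (get s) (o.map (e k).symm)))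
      (embed r e get put q)
  | .pop k f q => .pop (r k) (fun s o => put (f (get s) (o.map (e k).symm))) (embed r e get put q)
  | .load a q => .load (fun s => put (a (get s))) (embed r e get put q)
  | .branch f q₁ q₂ => .branch (fun s => f (get s)) (embed r e get put q₁) (embed r e get put q₂)
  | .goto f => .goto fun s => f (get s)
  | .halt => .halt

/-- `S'` holds a copy of the stacks `S k`, `k ∈ U`, and agrees with `T` elsewhere. -/
def StackCopy (U : Set K) (r : K → K') (e : ∀ k, Γ k ≃ Γ' (r k)) (T : ∀ k, List (Γ' k))
    (S : ∀ k, List (Γ k)) (S' : ∀ k, List (Γ' k)) : Prop :=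
  (∀ k ∈ U, S' (r k) = (S k).map (e k)) ∧ ∀ k', (∀ k ∈ U, r k ≠ k') → S' k' = T k'

variable [DecidableEq K] [DecidableEq K']

theorem StackCopy.update {U : Set K} {r : K → K'} (hr : Set.InjOn r U) {e : ∀ k, Γ k ≃ Γ' (r k)}
    {T : ∀ k, List (Γ' k)} {S : ∀ k, List (Γ k)} {S' : ∀ k, List (Γ' k)}
    (h : StackCopy U r e T S S') {k : K} (hk : k ∈ U) {l : List (Γ k)} {l' : List (Γ' (r k))}
    (hl : l' = l.map (e k)) :
    StackCopy U r e T (Function.update S k l) (Function.update S' (r k) l') := by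
  refine ⟨fun j hj => ?_, fun k' hk' => ?_⟩
  · by_cases hjk : j = k
    · subst hjk; simp [hl]
    · rw [Function.update_of_ne hjk, Function.update_of_ne fun h => hjk (hr hj hk h), h.1 j hj]
  · rw [Function.update_of_ne fun h => hk' k hk h.symm, h.2 k' hk']

theorem StackCopy.stepAux {U : Set K} {r : K → K'} (hr : Set.InjOn r U)
    {e : ∀ k, Γ k ≃ Γ' (r k)} {get : σ' → σ} {put : σ → σ'} (hp : ∀ s, get (put s) = s)
    {T : ∀ k, List (Γ' k)} {q : TM2.Stmt Γ Λ σ} (hq : TM2Stmt.UsesIn U q) {v : σ}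
    {S : ∀ k, List (Γ k)} {S' : ∀ k, List (Γ' k)} (h : StackCopy U r e T S S') :
    ∃ S₁', TM2.stepAux (TM2Stmt.embed r e get put q) (put v) S' =
        ⟨(TM2.stepAux q v S).l, put (TM2.stepAux q v S).var, S₁'⟩ ∧
      StackCopy U r e T (TM2.stepAux q v S).stk S₁' := by
  have hd : ∀ k ∈ U, Option.map (e k).symm (S' (r k)).head? = (S k).head? := by
    intro k hk; rw [h.1 k hk]; cases S k <;> simp
  induction q generalizing v S S' with
  | push k f q ih =>
    have h' := h.update hr hq.1 (l := f v :: S k) (l' := e k (f (get (put v))) :: S' (r k))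
      (by simp [hp, h.1 k hq.1])
    exact ih hq.2 h' fun k hk => by rw [h'.1 k hk]; cases Function.update S _ _ k <;> simp
  | peek k f q ih =>
    simp only [TM2Stmt.embed, TM2.stepAux, hp, hd k hq.1]
    exact ih hq.2 h hd
  | pop k f q ih =>
    simp only [TM2Stmt.embed, TM2.stepAux, hp, hd k hq.1]
    have h' := h.update hr hq.1 (l := (S k).tail) (l' := (S' (r k)).tail)
      (by simp [h.1 k hq.1])
    exact ih hq.2 h' fun k hk => by rw [h'.1 k hk]; cases Function.update S _ _ k <;> simp
  | load a q ih =>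
    simp only [TM2Stmt.embed, TM2.stepAux, hp]
    exact ih hq h hd
  | branch f q₁ q₂ ih₁ ih₂ =>
    simp only [TM2Stmt.embed, TM2.stepAux, hp]
    cases f v
    · exact ih₂ hq.2 h hd
    · exact ih₁ hq.1 h hd
  | goto f => exact ⟨S', by simp [TM2Stmt.embed, hp], h⟩
  | halt => exact ⟨S', by simp [TM2Stmt.embed], h⟩

/-- The two machines run in lockstep, so running times carry over exactly. Injectivity is needed
only on the stacks in use, which later permits folding infinitely many registers into finitely many.
-/
theorem StackCopy.stepsTo {U : Set K} {r : K → K'} (hr : Set.InjOn r U)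
    {e : ∀ k, Γ k ≃ Γ' (r k)} {get : σ' → σ} {put : σ → σ'} (hp : ∀ s, get (put s) = s)
    {T : ∀ k, List (Γ' k)} {M : Λ → TM2.Stmt Γ Λ σ} (hM : ∀ l, TM2Stmt.UsesIn U (M l)) {n : ℕ}
    {l l' : Option Λ} {v v' : σ} {S S₁ : ∀ k, List (Γ k)} {S' : ∀ k, List (Γ' k)}
    (hS : StackCopy U r e T S S') (h : StepsTo M n ⟨l, v, S⟩ ⟨l', v', S₁⟩) :
    ∃ S₁', StepsTo (fun l => TM2Stmt.embed r e get put (M l)) n ⟨l, put v, S'⟩ ⟨l', put v', S₁'⟩ ∧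
      StackCopy U r e T S₁ S₁' := by
  induction n generalizing l v S S' with
  | zero => cases h; exact ⟨S', .refl _, hS⟩
  | succ n ih =>
    cases h with
    | @head _ _ c _ h h' =>
      cases l with
      | none => cases h
      | some l =>
        have hc : TM2.stepAux (M l) v S = c := by simpa [TM2.step] using h
        obtain ⟨S₂, h₁, h₂⟩ := hS.stepAux hr hp (hM l) (v := v)
        rw [hc] at h₁ h₂
        obtain ⟨S₃, h₃, h₄⟩ := ih h₂ h'
        exact ⟨S₃, .head (by simp [TM2.step, h₁]) h₃, h₄⟩

end Embed

/-! ### Register machines with an oracle -/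

/-- Stack alphabets: those of the oracle machine, and registers with alphabet `Γ'`. -/
def RegΓ (tm : FinTM2) : tm.K ⊕ ℕ → Type := Sum.elim tm.Γ fun _ => Γ'

/-- Fragments working on the stacks of the oracle machine and on registers. -/
abbrev RegFrag (tm : FinTM2) : Type 1 := Frag (RegΓ tm) (tm.σ × Option Γ')

/-- The stacks of the oracle are given by `S`, the registers by `r`. -/
def oracleStacks {tm : FinTM2} (S : ∀ k, List (tm.Γ k)) (r : ℕ → List Γ') :
    ∀ k, List (RegΓ tm k)
  | .inl k => S k
  | .inr i => r i

/-- The stacks of the oracle are empty, the registers are given by `r`. -/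
abbrev regStacks (tm : FinTM2) (r : ℕ → List Γ') : ∀ k, List (RegΓ tm k) :=
  oracleStacks (fun _ => []) r

namespace RegFrag

variable {tm : FinTM2}

/-- The internal state at the beginning and at the end of a fragment. -/
def idle (tm : FinTM2) : tm.σ × Option Γ' := (tm.initialState, none)

/-- The internal state used as a flag. -/
def flag (tm : FinTM2) : tm.σ × Option Γ' := (tm.initialState, some default)

theorem flag_ne_idle (tm : FinTM2) : flag tm ≠ idle tm := by simp [flag, idle]

/-- The fragment turns the registers `r` into `r'` within `t` steps. -/
def Runs (F : RegFrag tm) (t : ℕ) (r r' : ℕ → List Γ') : Prop :=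
  Frag.Runs F (idle tm) t (regStacks tm r) (regStacks tm r')

theorem oracleStacks_update_right (S : ∀ k, List (tm.Γ k)) (r : ℕ → List Γ') (i : ℕ)
    (l : List Γ') : oracleStacks S (Function.update r i l) =
      Function.update (β := fun k => List (RegΓ tm k)) (oracleStacks S r) (Sum.inr i) l := by
  funext k
  rcases k with k | j
  · exact (Function.update_of_ne (by simp) _ _).symm
  · by_cases h : j = i
    · subst h
      exact (Function.update_self _ _ _).trans
        (Function.update_self (β := fun k => List (RegΓ tm k)) (Sum.inr j) l
          (oracleStacks S r)).symm
    · exact (Function.update_of_ne h _ _).trans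
        (Function.update_of_ne (β := fun k => List (RegΓ tm k)) (a := Sum.inr j) (a' := Sum.inr i)
          (fun e => h (Sum.inr.inj e)) l (oracleStacks S r)).symm

theorem oracleStacks_update_left (S : ∀ k, List (tm.Γ k)) (r : ℕ → List Γ') (i : tm.K)
    (l : List (tm.Γ i)) : oracleStacks (Function.update S i l) r =
      Function.update (β := fun k => List (RegΓ tm k)) (oracleStacks S r) (Sum.inl i) l := by
  funext k
  rcases k with k | j
  · by_cases h : k = i
    · subst h
      exact (Function.update_self _ _ _).trans
        (Function.update_self (β := fun k => List (RegΓ tm k)) (Sum.inl k) l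
          (oracleStacks S r)).symm
    · exact (Function.update_of_ne h _ _).trans
        (Function.update_of_ne (β := fun k => List (RegΓ tm k)) (a := Sum.inl k) (a' := Sum.inl i)
          (fun e => h (Sum.inl.inj e)) l (oracleStacks S r)).symm
  · exact (Function.update_of_ne (by simp) _ _).symm

/-- Push a symbol on register `i`. -/
def pushReg {Λ : Type} (i : ℕ) (f : tm.σ × Option Γ' → Γ')
    (q : TM2.Stmt (RegΓ tm) Λ (tm.σ × Option Γ')) : TM2.Stmt (RegΓ tm) Λ (tm.σ × Option Γ') :=
  .push (.inr i) f q

/-- Pop a symbol from register `i`, and store it in the internal state. -/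
def popReg {Λ : Type} (i : ℕ) (q : TM2.Stmt (RegΓ tm) Λ (tm.σ × Option Γ')) :
    TM2.Stmt (RegΓ tm) Λ (tm.σ × Option Γ') :=
  .pop (.inr i) (fun s (o : Option Γ') => (s.1, o)) q

/-- Forget the stored symbol and halt. -/
def resetHalt {Λ : Type} : TM2.Stmt (RegΓ tm) Λ (tm.σ × Option Γ') :=
  .load (fun s => (s.1, none)) .halt

variable {Λ : Type}

theorem stepAux_pushReg (i : ℕ) (f : tm.σ × Option Γ' → Γ')
    (q : TM2.Stmt (RegΓ tm) Λ (tm.σ × Option Γ')) (v : tm.σ × Option Γ') (S : ∀ k, List (tm.Γ k))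
    (r : ℕ → List Γ') :
    TM2.stepAux (pushReg i f q) v (oracleStacks S r) =
      TM2.stepAux q v (oracleStacks S (Function.update r i (f v :: r i))) := by
  rw [oracleStacks_update_right]; rfl

theorem stepAux_popReg (i : ℕ) (q : TM2.Stmt (RegΓ tm) Λ (tm.σ × Option Γ'))
    (v : tm.σ × Option Γ') (S : ∀ k, List (tm.Γ k)) (r : ℕ → List Γ') :
    TM2.stepAux (popReg i q) v (oracleStacks S r) =
      TM2.stepAux q (v.1, (r i).head?) (oracleStacks S (Function.update r i (r i).tail)) := by
  rw [oracleStacks_update_right]; rfl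

theorem stepAux_resetHalt (v : tm.σ × Option Γ') (S : ∀ k, List (RegΓ tm k)) :
    TM2.stepAux (resetHalt (Λ := Λ)) v S = ⟨none, (v.1, none), S⟩ := rfl

theorem Runs.mono {F : RegFrag tm} {t t' : ℕ} {r r' : ℕ → List Γ'} (h : Runs F t r r')
    (ht : t ≤ t') : Runs F t' r r' :=
  Frag.Runs.mono h ht

theorem Runs.seq {F G : RegFrag tm} {t u : ℕ} {r r' r'' : ℕ → List Γ'} (hF : Runs F t r r')
    (hG : Runs G u r' r'') : Runs (Frag.seq F G) (t + u) r r'' :=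
  Frag.Runs.seq hF hG

/-- Branch on the top symbol of register `i`. -/
noncomputable def ite (i : ℕ) (p : Option Γ' → Bool) (F G : RegFrag tm) : RegFrag tm :=
  Frag.ite (idle tm) (flag tm) (Sum.inr i : tm.K ⊕ ℕ) p F G

/-- Loop as long as register `i` is non-empty. -/
noncomputable def loop (i : ℕ) (F : RegFrag tm) : RegFrag tm :=
  Frag.loop (idle tm) (flag tm) (Sum.inr i : tm.K ⊕ ℕ) (fun o : Option Γ' => o.isSome) F

theorem Runs.ite {F G : RegFrag tm} {i t : ℕ} {p : Option Γ' → Bool} {r r' : ℕ → List Γ'}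
    (hF : p (r i).head? = true → Runs F t r r') (hG : p (r i).head? = false → Runs G t r r') :
    Runs (RegFrag.ite i p F G) (t + 1) r r' := by
  cases h : p (r i).head?
  · exact Frag.Runs.ite_false (flag_ne_idle tm) h (hG h)
  · exact Frag.Runs.ite_true (flag_ne_idle tm) h (hF h)

theorem Runs.loop {F : RegFrag tm} {i t n : ℕ} (r : ℕ → ℕ → List Γ')
    (hF : ∀ j < n, r j i ≠ [] ∧ Runs F t (r j) (r (j + 1))) (hn : r n i = []) :
    Runs (RegFrag.loop i F) (n * (t + 1) + 1) (r 0) (r n) :=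
  Frag.Runs.loop (flag_ne_idle tm) (fun j => regStacks tm (r j))
    (fun j hj => by
      change (r j i).head?.isSome = true
      have := (hF j hj).1
      cases h : r j i <;> simp_all)
    (fun j hj => (hF j hj).2) (by change (r n i).head?.isSome = false; simp [hn])

/-- Push the symbol `a` on register `i`. -/
def push (i : ℕ) (a : Γ') : RegFrag tm := Frag.op (pushReg i (fun _ => a) resetHalt)

theorem Runs.push (i : ℕ) (a : Γ') (r : ℕ → List Γ') :
    Runs (RegFrag.push (tm := tm) i a) 1 r (Function.update r i (a :: r i)) :=
  Frag.Runs.op (by rw [stepAux_pushReg, stepAux_resetHalt]; rfl)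

/-- Remove the top symbol of register `i`. -/
def pop (i : ℕ) : RegFrag tm := Frag.op (popReg i resetHalt)

theorem Runs.pop (i : ℕ) (r : ℕ → List Γ') :
    Runs (RegFrag.pop (tm := tm) i) 1 r (Function.update r i (r i).tail) :=
  Frag.Runs.op (by rw [stepAux_popReg, stepAux_resetHalt]; rfl)

/-- Move the top symbol of register `i` to register `j` if there is one. -/
def moveOne (i j : ℕ) : RegFrag tm :=
  Frag.op (popReg i (.branch (fun s => s.2.isSome)
    (pushReg j (fun s => s.2.getD default) resetHalt) resetHalt))

theorem Runs.moveOne {i j : ℕ} (hij : i ≠ j) (r : ℕ → List Γ') :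
    Runs (RegFrag.moveOne (tm := tm) i j) 1 r
      (Function.update (Function.update r i (r i).tail) j ((r i).head?.toList ++ r j)) := by
  refine Frag.Runs.op ?_
  rw [stepAux_popReg, TM2.stepAux.eq_5]
  cases hr : r i with
  | nil =>
    have h : Function.update r i [] j = r j := Function.update_of_ne hij.symm _ _
    simp [stepAux_resetHalt, idle]
    rw [← h, Function.update_eq_self]
  | cons a l => simp [stepAux_resetHalt, stepAux_pushReg, idle, hij.symm]

/-- Move the top symbol of register `i` to the registers `j` and `k` if there is one. -/
def moveTwo (i j k : ℕ) : RegFrag tm :=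
  Frag.op (popReg i (.branch (fun s => s.2.isSome)
    (pushReg j (fun s => s.2.getD default) (pushReg k (fun s => s.2.getD default) resetHalt))
    resetHalt))

theorem Runs.moveTwo {i j k : ℕ} (hij : i ≠ j) (hik : i ≠ k) (hjk : j ≠ k) (r : ℕ → List Γ')
    {a : Γ'} {l : List Γ'} (hr : r i = a :: l) :
    Runs (RegFrag.moveTwo (tm := tm) i j k) 1 r
      (Function.update (Function.update (Function.update r i l) j (a :: r j)) k (a :: r k)) := by
  refine Frag.Runs.op ?_
  rw [stepAux_popReg, TM2.stepAux.eq_5]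
  simp [stepAux_resetHalt, stepAux_pushReg, idle, hr, hij.symm, hik.symm, hjk.symm]

/-- Empty register `i`. -/
noncomputable def clear (i : ℕ) : RegFrag tm := loop i (pop i)

theorem Runs.clear (i : ℕ) (r : ℕ → List Γ') :
    Runs (RegFrag.clear (tm := tm) i) (2 * (r i).length + 1) r (Function.update r i []) := by
  have h := Runs.loop (tm := tm) (F := RegFrag.pop i) (i := i) (t := 1) (n := (r i).length)
    (fun j => Function.update r i ((r i).drop j)) (fun j hj => ⟨?_, ?_⟩) (by simp)
  · simp at h
    rw [mul_comm]
    exact h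
  · simpa using hj
  · simpa using Runs.pop (tm := tm) i (Function.update r i ((r i).drop j))

/-- Move the content of register `i` to register `j`, reversing it. -/
noncomputable def move (i j : ℕ) : RegFrag tm := loop i (moveOne i j)

theorem Runs.move {i j : ℕ} (hij : i ≠ j) (r : ℕ → List Γ') :
    Runs (RegFrag.move (tm := tm) i j) (2 * (r i).length + 1) r
      (Function.update (Function.update r i []) j ((r i).reverse ++ r j)) := by
  have h := Runs.loop (tm := tm) (F := RegFrag.moveOne i j) (i := i) (t := 1) (n := (r i).length)
    (fun k => Function.update (Function.update r i ((r i).drop k)) j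
      (((r i).take k).reverse ++ r j)) (fun k hk => ⟨?_, ?_⟩) (by simp [hij])
  · simp at h
    rw [mul_comm]
    exact h
  · simpa [hij] using hk
  · have htake : ((r i).take (k + 1)).reverse = (r i)[k] :: ((r i).take k).reverse := by
      rw [List.take_add_one, List.getElem?_eq_getElem hk]; simp
    convert Runs.moveOne (tm := tm) hij (Function.update (Function.update r i ((r i).drop k)) j
      (((r i).take k).reverse ++ r j)) using 1
    funext m
    by_cases hmj : m = j
    · subst hmj; simp [hij, htake, List.getElem?_eq_getElem hk]
    · by_cases hmi : m = i
      · subst hmi; simp [hij]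
      · simp [hmi, hmj]

/-- Move the content of register `i` to the registers `j` and `k`, reversing it. -/
noncomputable def moveBoth (i j k : ℕ) : RegFrag tm := loop i (moveTwo i j k)

theorem Runs.moveBoth {i j k : ℕ} (hij : i ≠ j) (hik : i ≠ k) (hjk : j ≠ k) (r : ℕ → List Γ') :
    Runs (RegFrag.moveBoth (tm := tm) i j k) (2 * (r i).length + 1) r
      (Function.update (Function.update (Function.update r i []) j ((r i).reverse ++ r j)) k
        ((r i).reverse ++ r k)) := by
  have h := Runs.loop (tm := tm) (F := RegFrag.moveTwo i j k) (i := i) (t := 1) (n := (r i).length)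
    (fun n => Function.update (Function.update (Function.update r i ((r i).drop n)) j
      (((r i).take n).reverse ++ r j)) k (((r i).take n).reverse ++ r k))
      (fun n hn => ⟨?_, ?_⟩) (by simp [hij, hik])
  · simp at h
    rw [mul_comm]
    exact h
  · simpa [hij, hik] using hn
  · have htake : ((r i).take (n + 1)).reverse = (r i)[n] :: ((r i).take n).reverse := by
      rw [List.take_add_one, List.getElem?_eq_getElem hn]; simp
    convert Runs.moveTwo (tm := tm) hij hik hjk (Function.update (Function.update
      (Function.update r i ((r i).drop n)) j (((r i).take n).reverse ++ r j)) k
      (((r i).take n).reverse ++ r k)) (a := (r i)[n]) (l := (r i).drop (n + 1)) ?_ using 1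
    · funext m
      by_cases hmk : m = k
      · subst hmk; simp [htake]
      · by_cases hmj : m = j
        · subst hmj; simp [hjk, htake]
        · by_cases hmi : m = i
          · subst hmi; simp [hij, hik]
          · simp [hmi, hmj, hmk]
    · simp [hij, hik]

/-- Apply the map `ρ` to the registers. -/
def rename (ρ : ℕ → ℕ) (F : RegFrag tm) : RegFrag tm where
  Λ := F.Λ
  main := F.main
  code l := TM2Stmt.embed (Γ := RegΓ tm) (Γ' := RegΓ tm) (Sum.map id ρ)
    (fun | .inl _ => Equiv.refl _ | .inr _ => Equiv.refl _) id id (F.code l)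

/-- The renamed fragment never touches registers outside the range of `ρ`, so a change of one
register remains a change of one register. -/
theorem Runs.rename {F : RegFrag tm} {ρ : ℕ → ℕ} (hρ : Function.Injective ρ) {t : ℕ}
    {r : ℕ → List Γ'} {i : ℕ} {l : List Γ'}
    (h : Runs F t (fun j => r (ρ j)) (Function.update (fun j => r (ρ j)) i l)) :
    Runs (RegFrag.rename ρ F) t r (Function.update r (ρ i) l) := by
  obtain ⟨n, hn, h⟩ := h
  have hcopy : StackCopy (Γ := RegΓ tm) (Γ' := RegΓ tm) Set.univ (Sum.map id ρ)
      (fun | .inl _ => Equiv.refl _ | .inr _ => Equiv.refl _) (regStacks tm r)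
      (regStacks tm fun j => r (ρ j)) (regStacks tm r) := by
    refine ⟨fun k _ => ?_, fun _ _ => rfl⟩
    rcases k with k | k
    · rfl
    · exact (List.map_id _).symm
  have hinj : Function.Injective (Sum.map id ρ : tm.K ⊕ ℕ → tm.K ⊕ ℕ) :=
    Sum.map_injective.2 ⟨Function.injective_id, hρ⟩
  obtain ⟨S, hS, hS'⟩ := hcopy.stepsTo (get := id) (put := id) hinj.injOn (fun _ => rfl)
    (fun l => TM2Stmt.usesIn_univ _) h
  refine ⟨n, hn, ?_⟩
  suffices h : regStacks tm (Function.update r (ρ i) l) = S by rw [h]; exact hS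
  funext k
  rcases k with k | k
  · have := hS'.1 (.inl k) trivial
    exact this.symm
  · by_cases hk : ∃ j, ρ j = k
    · obtain ⟨j, rfl⟩ := hk
      have := hS'.1 (.inr j) trivial
      refine Eq.trans ?_ this.symm
      refine Eq.trans ?_ (List.map_id _).symm
      by_cases hj : j = i
      · subst hj; simp [oracleStacks]; rfl
      · simp [oracleStacks, hj, hρ.ne hj]; rfl
    · have := hS'.2 (.inr k) fun j _ h => by
        rcases j with j | j
        · cases h
        · exact hk ⟨j, Sum.inr.inj h⟩
      rw [this]
      have : k ≠ ρ i := fun h => hk ⟨i, h.symm⟩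
      simp [oracleStacks, this]; rfl

end RegFrag

/-! ### Families of words computable in polynomial time from registers -/

theorem RegFrag.Runs.cast {tm : FinTM2} {F : RegFrag tm} {t t' : ℕ} {r r' r'' : ℕ → List Γ'}
    (h : F.Runs t r r') (ht : t ≤ t') (hr : r'' = r') : F.Runs t' r r'' :=
  hr ▸ h.mono ht

theorem natPolynomial_eval_mono (p : Polynomial ℕ) : Monotone fun n => p.eval n := by
  intro a b h
  simp only [Polynomial.eval_eq_sum, Polynomial.sum]
  gcongr

/-- The words held by the first `n` registers, depending on a parameter `x`; running times are
measured in terms of `sz x`. -/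
structure RegContext (X : Type) where
  /-- number of registers in use -/
  n : ℕ
  /-- content of the registers -/
  env : ℕ → X → List Γ'
  /-- size of the parameter -/
  sz : X → ℕ
  bound : ∃ p : Polynomial ℕ, ∀ x, ∀ i < n, (env i x).length ≤ p.eval (sz x)

/-- The symbol used for unary numbers. -/
abbrev tick : Γ' := Γ'.bit true

/-- The context extended by a register with a number in unary. -/
def RegContext.index {X : Type} (C : RegContext X) : RegContext (X × ℕ) where
  n := C.n + 1
  env i p := if i < C.n then C.env i p.1 else List.replicate p.2 tick
  sz p := C.sz p.1 + p.2
  bound := by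
    obtain ⟨p, hp⟩ := C.bound
    refine ⟨p + .X, fun x i _ => ?_⟩
    by_cases hi : i < C.n
    · have := natPolynomial_eval_mono p (Nat.le_add_right (C.sz x.1) x.2)
      have := hp x.1 i hi
      simp [hi]
      simp at *
      omega
    · simp [hi]
      omega

/-- Some fragment puts the word `f x` on top of register `C.n` in polynomial time, given the
registers `C.env i x`, `i < C.n`. -/
def PolyTime (tm : FinTM2) {X : Type} (C : RegContext X) (f : X → List Γ') : Prop :=
  ∃ (F : RegFrag tm) (p : Polynomial ℕ), ∀ x, (f x).length ≤ p.eval (C.sz x) ∧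
    ∀ r : ℕ → List Γ', (∀ i < C.n, r i = C.env i x) → (∀ i > C.n, r i = []) →
      F.Runs (p.eval (C.sz x)) r (Function.update r C.n (f x ++ r C.n))

namespace PolyTime

variable {tm : FinTM2} {X : Type} {C : RegContext X} {f g : X → List Γ'}

theorem rename (h : PolyTime tm C f) {ρ : ℕ → ℕ} (hρ : Function.Injective ρ) :
    ∃ (F : RegFrag tm) (p : Polynomial ℕ), ∀ x, (f x).length ≤ p.eval (C.sz x) ∧
      ∀ r : ℕ → List Γ', (∀ i < C.n, r (ρ i) = C.env i x) → (∀ i > C.n, r (ρ i) = []) →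
        F.Runs (p.eval (C.sz x)) r (Function.update r (ρ C.n) (f x ++ r (ρ C.n))) := by
  obtain ⟨F, p, h⟩ := h
  exact ⟨F.rename ρ, p, fun x => ⟨(h x).1, fun r h₁ h₂ =>
    RegFrag.Runs.rename hρ ((h x).2 (fun i => r (ρ i)) h₁ h₂)⟩⟩

/-- The output register and the beginning of the scratch registers can be chosen. -/
theorem place (h : PolyTime tm C f) (out scratch : ℕ) (h₁ : C.n ≤ out) (h₂ : out < scratch) :
    ∃ (F : RegFrag tm) (p : Polynomial ℕ), ∀ x, (f x).length ≤ p.eval (C.sz x) ∧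
      ∀ r : ℕ → List Γ', (∀ i < C.n, r i = C.env i x) → (∀ i ≥ scratch, r i = []) →
        F.Runs (p.eval (C.sz x)) r (Function.update r out (f x ++ r out)) := by
  have hρ : Function.Injective fun i =>
      if i < C.n then i else if i = C.n then out else scratch + (i - C.n) := by
    intro i j hij
    simp only at hij
    split_ifs at hij <;> omega
  obtain ⟨F, p, h⟩ := h.rename hρ
  refine ⟨F, p, fun x => ⟨(h x).1, fun r hr hr' => ?_⟩⟩
  have := (h x).2 r (fun i hi => by simp [hi, hr]) (fun i hi => hr' _ ?_)
  · simpa using this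
  · split_ifs <;> omega

theorem nil : PolyTime tm C fun _ => [] := by
  -- Both registers are empty scratch registers, so this move does nothing.
  refine ⟨RegFrag.moveOne (C.n + 1) (C.n + 2), 1, fun x => ⟨by simp, fun r _ h => ?_⟩⟩
  convert RegFrag.Runs.moveOne (tm := tm) (i := C.n + 1) (j := C.n + 2) (by omega) r using 1
  · simp
  · funext k
    by_cases h₁ : k = C.n + 1
    · subst h₁; simp [h]
    · by_cases h₂ : k = C.n + 2
      · subst h₂; simp [h]
      · by_cases h₃ : k = C.n
        · subst h₃; simp
        · simp [h₁, h₂, h₃]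

theorem symbol (a : Γ') : PolyTime tm C fun _ => [a] :=
  ⟨RegFrag.push C.n a, 1, fun x => ⟨by simp, fun r _ _ => by
    simpa using RegFrag.Runs.push (tm := tm) C.n a r⟩⟩

theorem append (hf : PolyTime tm C f) (hg : PolyTime tm C g) :
    PolyTime tm C fun x => f x ++ g x := by
  obtain ⟨F, p, hf⟩ := hf
  obtain ⟨G, q, hg⟩ := hg
  -- The output is a stack, so the second word has to be pushed first.
  refine ⟨G.seq F, q + p, fun x => ⟨?_, fun r h h' => ?_⟩⟩
  · have := (hf x).1
    have := (hg x).1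
    simp
    omega
  · have h₁ := (hg x).2 r h h'
    have h₂ := (hf x).2 (Function.update r C.n (g x ++ r C.n))
      (fun i hi => by rw [Function.update_of_ne hi.ne, h i hi])
      (fun i hi => by rw [Function.update_of_ne (Nat.ne_of_gt hi), h' i hi])
    simpa using h₁.seq h₂

/-- The content of a register. -/
theorem var {i : ℕ} (hi : i < C.n) : PolyTime tm C (C.env i) := by
  obtain ⟨p, hp⟩ := C.bound
  -- Two reversals restore the order: the word goes to scratch, then back to its register and to the
  -- output at once.
  refine ⟨(RegFrag.move i (C.n + 1)).seq (RegFrag.moveBoth (C.n + 1) i C.n),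
    4 * p + 2, fun x => ⟨?_, fun r h h' => ?_⟩⟩
  · have := hp x i hi
    simp
    omega
  · have h₁ := RegFrag.Runs.move (tm := tm) (show i ≠ C.n + 1 by omega) r
    have h₂ := RegFrag.Runs.moveBoth (tm := tm) (i := C.n + 1) (j := i) (k := C.n) (by omega)
      (by omega) (by omega) (Function.update (Function.update r i []) (C.n + 1)
        ((r i).reverse ++ r (C.n + 1)))
    have := hp x i hi
    rw [← h i hi] at this ⊢
    have hn : C.n ≠ i := by omega
    refine (h₁.seq h₂).cast ?_ ?_
    · simp [h' (C.n + 1) (by omega)]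
      omega
    · funext k
      by_cases e₁ : k = C.n + 1
      · subst e₁; simp [h', show C.n + 1 ≠ i by omega]
      · by_cases e₂ : k = i
        · subst e₂; simp [h', e₁, hn.symm]
        · by_cases e₃ : k = C.n
          · subst e₃; simp [h', e₂]
          · simp [e₁, e₂, e₃]

/-- Branch on the first symbol of a word. -/
theorem iteHead {c : X → List Γ'} (hc : PolyTime tm C c) (p : Option Γ' → Bool)
    (hf : PolyTime tm C f) (hg : PolyTime tm C g) :
    PolyTime tm C fun x => if p (c x).head? then f x else g x := by
  obtain ⟨Fc, pc, hc⟩ := hc.place (C.n + 1) (C.n + 2) (by omega) (by omega)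
  obtain ⟨F, pf, hf⟩ := hf
  obtain ⟨G, pg, hg⟩ := hg
  -- The tested word is erased at the start of each branch, because `F` and `G` expect empty scratch
  -- registers.
  refine ⟨Fc.seq (RegFrag.ite (C.n + 1) p ((RegFrag.clear (C.n + 1)).seq F)
    ((RegFrag.clear (C.n + 1)).seq G)), 3 * pc + pf + pg + 2, fun x => ⟨?_, fun r h h' => ?_⟩⟩
  · have := (hf x).1
    have := (hg x).1
    simp
    split_ifs <;> omega
  · have h₁ := (hc x).2 r h (fun i hi => h' i (by omega))
    rw [h' (C.n + 1) (by omega), List.append_nil] at h₁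
    set r₁ := Function.update r (C.n + 1) (c x) with hr₁
    have h₂ := RegFrag.Runs.clear (tm := tm) (C.n + 1) r₁
    have hr₂ : Function.update r₁ (C.n + 1) [] = r := by
      rw [hr₁, Function.update_idem, ← h' (C.n + 1) (by omega), Function.update_eq_self]
    have hr₃ : r₁ (C.n + 1) = c x := by simp [hr₁]
    rw [hr₂, hr₃] at h₂
    have hl := (hc x).1
    have h₃ : (RegFrag.ite (tm := tm) (C.n + 1) p ((RegFrag.clear (C.n + 1)).seq F)
        ((RegFrag.clear (C.n + 1)).seq G)).Runs
        ((2 * (c x).length + 1 + (pf.eval (C.sz x) + pg.eval (C.sz x))) + 1) r₁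
        (Function.update r C.n ((if p (c x).head? then f x else g x) ++ r C.n)) := by
      refine RegFrag.Runs.ite (fun hp => ?_) (fun hp => ?_)
      · rw [hr₃] at hp
        rw [if_pos hp]
        exact h₂.seq (((hf x).2 r h h').mono (by omega))
      · rw [hr₃] at hp
        rw [if_neg (by simp [hp])]
        exact h₂.seq (((hg x).2 r h h').mono (by omega))
    refine (h₁.seq h₃).mono ?_
    simp
    omega

/-- The symbol of the word `f x` at position `|g x|`. -/
theorem get (hf : PolyTime tm C f) (hg : PolyTime tm C g) :
    PolyTime tm C fun x => ((f x)[(g x).length]?).toList := by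
  obtain ⟨G, q, hg⟩ := hg.place (C.n + 2) (C.n + 3) (by omega) (by omega)
  obtain ⟨F, p, hf⟩ := hf.place (C.n + 1) (C.n + 3) (by omega) (by omega)
  -- Both words are popped in lockstep until the counter `g x` is used up. Popping an empty register
  -- is harmless, so a position past the end yields the empty word.
  refine ⟨(((G.seq F).seq (RegFrag.loop (C.n + 2) ((RegFrag.pop (C.n + 2)).seq
    (RegFrag.pop (C.n + 1))))).seq (RegFrag.moveOne (C.n + 1) C.n)).seq (RegFrag.clear (C.n + 1)),
    4 * q + 3 * p + 3, fun x => ⟨?_, fun r h h' => ?_⟩⟩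
  · have : ((f x)[(g x).length]?).toList.length ≤ 1 := by
      cases (f x)[(g x).length]? <;> simp
    simp
    omega
  · have h₁ := (hg x).2 r h (fun i hi => h' i (by omega))
    rw [h' (C.n + 2) (by omega), List.append_nil] at h₁
    have h₂ := (hf x).2 (Function.update r (C.n + 2) (g x))
      (fun i hi => by rw [Function.update_of_ne (by omega), h i hi])
      (fun i hi => by rw [Function.update_of_ne (by omega), h' i (by omega)])
    rw [Function.update_of_ne (show C.n + 1 ≠ C.n + 2 by omega), h' (C.n + 1) (by omega),
      List.append_nil] at h₂
    have h₃ := RegFrag.Runs.loop (tm := tm) (F := (RegFrag.pop (C.n + 2)).seq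
      (RegFrag.pop (C.n + 1))) (i := C.n + 2) (t := 2) (n := (g x).length)
      (fun j => Function.update (Function.update r (C.n + 2) ((g x).drop j)) (C.n + 1)
        ((f x).drop j)) (fun j hj => ⟨?_, ?_⟩) ?_
    · have h₄ := RegFrag.Runs.moveOne (tm := tm) (i := C.n + 1) (j := C.n) (by omega)
        (Function.update (Function.update r (C.n + 2) ((g x).drop (g x).length)) (C.n + 1)
        ((f x).drop (g x).length))
      have h₅ := RegFrag.Runs.clear (tm := tm) (C.n + 1) (Function.update (Function.update
        (Function.update (Function.update r (C.n + 2) ((g x).drop (g x).length)) (C.n + 1)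
        ((f x).drop (g x).length)) (C.n + 1) ((f x).drop (g x).length).tail) C.n
        ((f x)[(g x).length]?.toList ++ r C.n))
      have H := (((h₁.seq h₂).seq h₃).seq (by simpa using h₄)).seq (by simpa using h₅)
      refine H.cast ?_ ?_
      rotate_left
      · funext k
        by_cases h₁ : k = C.n + 1
        · subst h₁; simp [h']
        · by_cases h₂ : k = C.n + 2
          · subst h₂; simp [h']
          · by_cases h₃ : k = C.n
            · subst h₃; simp
            · simp [h₁, h₂, h₃]
      · have := (hf x).1
        have := (hg x).1
        simp
        omega
    · simp
      omega
    · have h₃ := (RegFrag.Runs.pop (tm := tm) (C.n + 2) (Function.update (Function.update r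
        (C.n + 2) ((g x).drop j)) (C.n + 1) ((f x).drop j))).seq (RegFrag.Runs.pop (C.n + 1) _)
      convert h₃ using 1
      funext k
      by_cases h₁ : k = C.n + 1
      · subst h₁; simp
      · by_cases h₂ : k = C.n + 2
        · subst h₂; simp
        · simp [h₁, h₂]
    · simp

/-- Concatenation of the words `g (x, i)`, `i < |f x|`. -/
theorem flatMap {g : X × ℕ → List Γ'} (hf : PolyTime tm C f) (hg : PolyTime tm C.index g) :
    PolyTime tm C fun x => (List.range (f x).length).flatMap fun i => g (x, i) := by
  obtain ⟨F, p, hf⟩ := hf.place (C.n + 2) (C.n + 3) (by omega) (by omega)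
  -- In the extended context the index is in register `C.n` and the output in `C.n + 1`; the swap
  -- makes all the words pile up on `C.n`.
  obtain ⟨G, q, hg⟩ := hg.rename (Equiv.swap C.n (C.n + 1)).injective
  have hq : ∀ x, ∀ i < (f x).length,
      q.eval (C.index.sz (x, i)) ≤ (q.comp (.X + p)).eval (C.sz x) := by
    intro x i hi
    have := (hf x).1
    simp only [Polynomial.eval_comp, Polynomial.eval_add, Polynomial.eval_X]
    refine natPolynomial_eval_mono q ?_
    simp only [RegContext.index]
    omega
  -- The first loop replaces `f x` by its length in unary. The second counts this index down, so the
  -- words are pushed from the last to the first.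
  refine ⟨(F.seq (RegFrag.loop (C.n + 2) ((RegFrag.pop (C.n + 2)).seq
    (RegFrag.push (C.n + 1) tick)))).seq (RegFrag.loop (C.n + 1) ((RegFrag.pop (C.n + 1)).seq G)),
    p + (3 * p + 1) + (p * (q.comp (.X + p) + 2) + 1), fun x => ⟨?_, fun r h h' => ?_⟩⟩
  · have : ((List.range (f x).length).flatMap fun i => g (x, i)).length ≤
        (f x).length * (q.comp (.X + p)).eval (C.sz x) := by
      rw [List.length_flatMap]
      refine (List.sum_le_card_nsmul _ ((q.comp (.X + p)).eval (C.sz x)) ?_).trans (by simp)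
      intro n hn
      obtain ⟨i, hi, rfl⟩ := List.mem_map.1 hn
      rw [List.mem_range] at hi
      exact (hg (x, i)).1.trans (hq x i hi)
    have := Nat.mul_le_mul_right ((q.comp (.X + p)).eval (C.sz x)) (hf x).1
    simp [mul_add] at *
    omega
  · have h₁ := (hf x).2 r h (fun i hi => h' i (by omega))
    rw [h' (C.n + 2) (by omega), List.append_nil] at h₁
    have h₂ := RegFrag.Runs.loop (tm := tm) (F := (RegFrag.pop (C.n + 2)).seq
      (RegFrag.push (C.n + 1) tick)) (i := C.n + 2) (t := 2) (n := (f x).length)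
      (fun j => Function.update (Function.update r (C.n + 1) (List.replicate j tick)) (C.n + 2)
        ((f x).drop j)) (fun j hj => ⟨?_, ?_⟩) ?_
    · have h₃ := RegFrag.Runs.loop (tm := tm) (F := (RegFrag.pop (C.n + 1)).seq G) (i := C.n + 1)
        (t := 1 + (q.comp (.X + p)).eval (C.sz x)) (n := (f x).length)
        (fun j => Function.update (Function.update r (C.n + 1)
          (List.replicate ((f x).length - j) tick)) C.n
          (((List.range (f x).length).drop ((f x).length - j)).flatMap (fun i => g (x, i)) ++
            r C.n)) (fun j hj => ⟨?_, ?_⟩) ?_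
      · have h₁₂ : Function.update r (C.n + 2) (f x) = Function.update (Function.update r (C.n + 1)
            (List.replicate 0 tick)) (C.n + 2) ((f x).drop 0) := by
          rw [List.replicate_zero, ← h' (C.n + 1) (by omega), Function.update_eq_self,
            List.drop_zero]
        have h₂₃ : Function.update (Function.update r (C.n + 1) (List.replicate (f x).length tick))
            (C.n + 2) ((f x).drop (f x).length) = Function.update (Function.update r (C.n + 1)
            (List.replicate ((f x).length - 0) tick)) C.n
            (((List.range (f x).length).drop ((f x).length - 0)).flatMap (fun i => g (x, i)) ++
            r C.n) := by
          funext k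
          by_cases h₁ : k = C.n + 2
          · subst h₁; simp [h']
          · by_cases h₂ : k = C.n
            · subst h₂; simp [List.drop_eq_nil_of_le]
            · simp [h₁, h₂]
        rw [h₁₂] at h₁
        rw [← h₂₃] at h₃
        refine ((h₁.seq h₂).seq h₃).cast ?_ ?_
        rotate_left
        · funext k
          by_cases h₁ : k = C.n + 1
          · subst h₁; simp [h']
          · by_cases h₂ : k = C.n
            · subst h₂; simp
            · simp [h₁, h₂]
        · have := (hf x).1
          have := Nat.mul_le_mul_right ((q.comp (.X + p)).eval (C.sz x)) (hf x).1
          simp only [Polynomial.eval_add, Polynomial.eval_mul, mul_add, Polynomial.eval_one,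
            Polynomial.eval_ofNat] at *
          omega
      · simp
        omega
      · obtain ⟨i, hi⟩ : ∃ i, (f x).length - j = i + 1 := ⟨(f x).length - j - 1, by omega⟩
        have hi' : (f x).length - (j + 1) = i := by omega
        have hil : i < (f x).length := by omega
        simp only [hi, hi']
        refine RegFrag.Runs.seq (RegFrag.Runs.pop _ _) ?_
        have := (hg (x, i)).2 (Function.update (Function.update r (C.n + 1)
          (List.replicate i tick)) C.n (((List.range (f x).length).drop (i + 1)).flatMap
          (fun i => g (x, i)) ++ r C.n)) ?_ ?_
        · have H := this.mono (hq x i hil)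
          simp only [RegContext.index, Equiv.swap_apply_right] at H
          convert H using 1
          · funext k
            by_cases h₁ : k = C.n + 1
            · subst h₁; simp
            · by_cases h₂ : k = C.n
              · subst h₂; simp
              · simp [h₁, h₂]
          · funext k
            rw [Function.update_idem, Function.update_self, ← List.append_assoc,
              List.drop_eq_getElem_cons (by simpa using hil)]
            simp
        · intro k hk
          simp only [RegContext.index] at hk ⊢
          by_cases hk' : k < C.n
          · rw [Equiv.swap_apply_of_ne_of_ne (by omega) (by omega),
              Function.update_of_ne (by omega), Function.update_of_ne (by omega), h k hk',
              if_pos hk']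
          · have : k = C.n := by omega
            subst this
            simp
        · intro k hk
          simp only [RegContext.index] at hk ⊢
          rw [Equiv.swap_apply_of_ne_of_ne (by omega) (by omega),
              Function.update_of_ne (by omega), Function.update_of_ne (by omega), h' k (by omega)]
      · simp
    · simp
      omega
    · have h₃ := (RegFrag.Runs.pop (tm := tm) (C.n + 2) (Function.update (Function.update r
        (C.n + 1) (List.replicate j tick)) (C.n + 2) ((f x).drop j))).seq
        (RegFrag.Runs.push (C.n + 1) tick _)
      convert h₃ using 1
      funext k
      by_cases h₁ : k = C.n + 1
      · subst h₁; simp [List.replicate_succ]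
      · by_cases h₂ : k = C.n + 2
        · subst h₂; simp
        · simp [h₁, h₂]
    · simp

/-- The additional register of an extended context may be ignored. -/
theorem weaken (hf : PolyTime tm C f) : PolyTime tm C.index fun p => f p.1 := by
  obtain ⟨F, p, hf⟩ := hf.place (C.n + 1) (C.n + 2) (by omega) (by omega)
  refine ⟨F, p, fun x => ?_⟩
  have hp : p.eval (C.sz x.1) ≤ p.eval (C.index.sz x) :=
    natPolynomial_eval_mono p (Nat.le_add_right (C.sz x.1) x.2)
  refine ⟨(hf x.1).1.trans hp, fun r h h' => ((hf x.1).2 r (fun i hi => ?_) h').mono hp⟩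
  rw [h i (by simp only [RegContext.index]; omega)]
  simp [RegContext.index, hi]

/-- The additional register of an extended context, in unary. -/
theorem indexVar : PolyTime tm C.index fun p => List.replicate p.2 tick := by
  have := var (tm := tm) (C := C.index) (i := C.n) (by simp [RegContext.index])
  simpa [RegContext.index] using this

end PolyTime

/-! ### Calling the oracle machine -/

namespace RegFrag

variable {tm : FinTM2}

theorem initList_eq (l : List (tm.Γ tm.k₀)) :
    initList tm l =
      ⟨some tm.main, tm.initialState, Function.update (fun _ => []) tm.k₀ l⟩ := by
  unfold initList
  congr
  funext k
  by_cases h : k = tm.k₀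
  · subst h; simp
  · simp [h]

theorem haltList_eq (l : List (tm.Γ tm.k₁)) :
    haltList tm l = ⟨none, tm.initialState, Function.update (fun _ => []) tm.k₁ l⟩ := by
  unfold haltList
  congr
  funext k
  by_cases h : k = tm.k₁
  · subst h; simp
  · simp [h]

/-- Push a symbol on a stack of the oracle. -/
def pushOracle {Λ : Type} (k : tm.K) (f : tm.σ × Option Γ' → tm.Γ k)
    (q : TM2.Stmt (RegΓ tm) Λ (tm.σ × Option Γ')) : TM2.Stmt (RegΓ tm) Λ (tm.σ × Option Γ') :=
  .push (.inl k) f q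

/-- Pop a symbol from a stack of the oracle, and store its image in the internal state. -/
def popOracle {Λ : Type} (k : tm.K) (e : tm.Γ k → Γ')
    (q : TM2.Stmt (RegΓ tm) Λ (tm.σ × Option Γ')) : TM2.Stmt (RegΓ tm) Λ (tm.σ × Option Γ') :=
  .pop (.inl k) (fun s (o : Option (tm.Γ k)) => (s.1, o.map e)) q

theorem stepAux_pushOracle {Λ : Type} (k : tm.K) (f : tm.σ × Option Γ' → tm.Γ k)
    (q : TM2.Stmt (RegΓ tm) Λ (tm.σ × Option Γ')) (v : tm.σ × Option Γ') (S : ∀ k, List (tm.Γ k))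
    (r : ℕ → List Γ') :
    TM2.stepAux (pushOracle k f q) v (oracleStacks S r) =
      TM2.stepAux q v (oracleStacks (Function.update S k (f v :: S k)) r) := by
  rw [oracleStacks_update_left]; rfl

theorem stepAux_popOracle {Λ : Type} (k : tm.K) (e : tm.Γ k → Γ')
    (q : TM2.Stmt (RegΓ tm) Λ (tm.σ × Option Γ')) (v : tm.σ × Option Γ') (S : ∀ k, List (tm.Γ k))
    (r : ℕ → List Γ') :
    TM2.stepAux (popOracle k e q) v (oracleStacks S r) =
      TM2.stepAux q (v.1, (S k).head?.map e)
        (oracleStacks (Function.update S k (S k).tail) r) := by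
  rw [oracleStacks_update_left]; rfl

/-- Move the top symbol of register `i` to the input stack of the oracle. -/
def feedOne (e : tm.Γ tm.k₀ ≃ Γ') (i : ℕ) : RegFrag tm :=
  Frag.op (popReg i (pushOracle tm.k₀ (fun s => e.symm (s.2.getD default)) resetHalt))

theorem runs_feedOne (e : tm.Γ tm.k₀ ≃ Γ') (i : ℕ) (S : ∀ k, List (tm.Γ k)) (r : ℕ → List Γ')
    {a : Γ'} {l : List Γ'} (hr : r i = a :: l) :
    Frag.Runs (feedOne e i) (idle tm) 1 (oracleStacks S r)
      (oracleStacks (Function.update S tm.k₀ (e.symm a :: S tm.k₀)) (Function.update r i l)) := by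
  refine Frag.Runs.op ?_
  rw [stepAux_popReg, stepAux_pushOracle, stepAux_resetHalt, hr]
  rfl

/-- Move the top symbol of the output stack of the oracle to register `i`. -/
def drainOne (e : tm.Γ tm.k₁ ≃ Γ') (i : ℕ) : RegFrag tm :=
  Frag.op (popOracle tm.k₁ e (pushReg i (fun s => s.2.getD default) resetHalt))

theorem runs_drainOne (e : tm.Γ tm.k₁ ≃ Γ') (i : ℕ) (S : ∀ k, List (tm.Γ k)) (r : ℕ → List Γ')
    {a : tm.Γ tm.k₁} {l : List (tm.Γ tm.k₁)} (hr : S tm.k₁ = a :: l) :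
    Frag.Runs (drainOne e i) (idle tm) 1 (oracleStacks S r)
      (oracleStacks (Function.update S tm.k₁ l) (Function.update r i (e a :: r i))) := by
  refine Frag.Runs.op ?_
  rw [stepAux_popOracle, stepAux_pushReg, stepAux_resetHalt, hr]
  rfl

/-- The oracle machine. -/
def oracle (tm : FinTM2) : RegFrag tm where
  Λ := tm.Λ
  fin := tm.ΛFin
  main := tm.main
  code l := TM2Stmt.embed (Γ := tm.Γ) (Γ' := RegΓ tm) Sum.inl (fun _ => Equiv.refl _) Prod.fst
    (fun s => (s, none)) (tm.m l)

theorem runs_oracle {l : List (tm.Γ tm.k₀)} {l' : List (tm.Γ tm.k₁)} {t : ℕ}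
    (h : TM2OutputsInTime tm l (some l') t) (r : ℕ → List Γ') :
    Frag.Runs (oracle tm) (idle tm) t (oracleStacks (Function.update (fun _ => []) tm.k₀ l) r)
      (oracleStacks (Function.update (fun _ => []) tm.k₁ l') r) := by
  obtain ⟨⟨n, h⟩, hn⟩ := h
  have h' : StepsTo tm.m n (initList tm l) (haltList tm l') := stepsTo_iff_iterate.2 h
  rw [initList_eq, haltList_eq] at h'
  have hcopy : StackCopy (Γ := tm.Γ) (Γ' := RegΓ tm) Set.univ Sum.inl (fun _ => Equiv.refl _)
      (oracleStacks (Function.update (fun _ => []) tm.k₀ l) r)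
      (Function.update (fun _ => []) tm.k₀ l)
      (oracleStacks (Function.update (fun _ => []) tm.k₀ l) r) :=
    ⟨fun k _ => (List.map_id _).symm, fun _ _ => rfl⟩
  obtain ⟨S, hS, hS'⟩ := hcopy.stepsTo (get := Prod.fst)
    (put := fun s => ((s, none) : tm.σ × Option Γ')) Sum.inl_injective.injOn (fun _ => rfl)
    (fun l => TM2Stmt.usesIn_univ _) h'
  refine ⟨n, hn, ?_⟩
  suffices h : oracleStacks (Function.update (fun _ => []) tm.k₁ l') r = S by rw [h]; exact hS
  funext k
  rcases k with k | k
  · exact ((hS'.1 k trivial).trans (List.map_id _)).symm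
  · exact (hS'.2 (.inr k) (by simp)).symm

/-- Transfer the word in register `i` to the oracle, run it, and transfer the reversed answer to
register `i`. -/
noncomputable def call (e₀ : tm.Γ tm.k₀ ≃ Γ') (e₁ : tm.Γ tm.k₁ ≃ Γ') (i : ℕ) : RegFrag tm :=
  (((move i (i + 1)).seq (Frag.loop (idle tm) (flag tm) (Sum.inr (i + 1) : tm.K ⊕ ℕ)
    (fun o : Option Γ' => o.isSome) (feedOne e₀ (i + 1)))).seq (oracle tm)).seq
    (Frag.loop (idle tm) (flag tm) (Sum.inl tm.k₁ : tm.K ⊕ ℕ)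
      (fun o : Option (tm.Γ tm.k₁) => o.isSome) (drainOne e₁ i))

/-- The input is reversed twice, on its way through register `i + 1` and again when it is fed to the
oracle; the answer is reversed once, when it is drained. -/
theorem Runs.call {e₀ : tm.Γ tm.k₀ ≃ Γ'} {e₁ : tm.Γ tm.k₁ ≃ Γ'} {i t : ℕ} {w w' : List Γ'}
    (h : TM2OutputsInTime tm (w.map e₀.invFun) (some (w'.map e₁.invFun)) t) {r : ℕ → List Γ'}
    (hr : r i = w) (hr' : r (i + 1) = []) :
    (RegFrag.call e₀ e₁ i).Runs (4 * w.length + 2 * w'.length + t + 3) r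
      (Function.update r i w'.reverse) := by
  have h₁ := Runs.move (tm := tm) (show i ≠ i + 1 by omega) r
  rw [hr, hr', List.append_nil] at h₁
  have h₂ := Frag.Runs.loop (flag_ne_idle tm) (k := Sum.inr (i + 1)) (F := feedOne e₀ (i + 1))
    (p := fun o : Option Γ' => o.isSome) (t := 1) (n := w.length)
    (fun j => oracleStacks (Function.update (fun _ => []) tm.k₀
      ((w.drop (w.length - j)).map e₀.symm)) (Function.update (Function.update r i []) (i + 1)
      (w.take (w.length - j)).reverse)) (fun j hj => ?_) (fun j hj => ?_) ?_
  · have h₃ := runs_oracle h (Function.update (Function.update r i []) (i + 1) [])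
    have h₄ := Frag.Runs.loop (flag_ne_idle tm) (k := Sum.inl tm.k₁) (F := drainOne e₁ i)
      (p := fun o : Option (tm.Γ tm.k₁) => o.isSome) (t := 1) (n := w'.length)
      (fun j => oracleStacks (Function.update (fun _ => []) tm.k₁ ((w'.drop j).map e₁.symm))
        (Function.update (Function.update r i (w'.take j).reverse) (i + 1) []))
        (fun j hj => ?_) (fun j hj => ?_) ?_
    · have e₁₂ : regStacks tm (Function.update (Function.update r i []) (i + 1) w.reverse) =
          oracleStacks (Function.update (fun _ => []) tm.k₀
            ((w.drop (w.length - 0)).map e₀.symm)) (Function.update (Function.update r i []) (i + 1)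
            (w.take (w.length - 0)).reverse) := by
        simp
      have e₂₃ : oracleStacks (Function.update (fun _ => []) tm.k₀
            ((w.drop (w.length - w.length)).map e₀.symm)) (Function.update (Function.update r i [])
            (i + 1) (w.take (w.length - w.length)).reverse) =
          oracleStacks (Function.update (fun _ => []) tm.k₀ (w.map e₀.invFun))
            (Function.update (Function.update r i []) (i + 1) []) := by
        simp
      have e₃₄ : oracleStacks (Function.update (fun _ => []) tm.k₁ (w'.map e₁.invFun))
            (Function.update (Function.update r i []) (i + 1) []) =
          oracleStacks (Function.update (fun _ => []) tm.k₁ ((w'.drop 0).map e₁.symm))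
            (Function.update (Function.update r i (w'.take 0).reverse) (i + 1) []) := by
        simp
      have e₄ : regStacks tm (Function.update r i w'.reverse) =
          oracleStacks (Function.update (fun _ => []) tm.k₁ ((w'.drop w'.length).map e₁.symm))
            (Function.update (Function.update r i (w'.take w'.length).reverse) (i + 1) []) := by
        rw [← hr', Function.update_comm (by omega), Function.update_eq_self]
        simp
      rw [← e₁₂, e₂₃] at h₂
      rw [← e₃₄, ← e₄] at h₄
      refine (Frag.Runs.seq (Frag.Runs.seq (Frag.Runs.seq h₁ h₂) h₃) h₄).mono ?_
      omega
    · change (Function.update (β := fun k => List (tm.Γ k)) (fun _ => []) tm.k₁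
        ((w'.drop j).map e₁.symm) tm.k₁).head?.isSome = true
      rw [Function.update_self, List.drop_eq_getElem_cons hj]
      rfl
    · have h := runs_drainOne e₁ i (Function.update (fun _ => []) tm.k₁ ((w'.drop j).map e₁.symm))
        (Function.update (Function.update r i (w'.take j).reverse) (i + 1) [])
        (a := e₁.symm w'[j]) (l := (w'.drop (j + 1)).map e₁.symm)
        (by rw [Function.update_self, List.drop_eq_getElem_cons hj]; rfl)
      have htake : (w'.take (j + 1)).reverse = w'[j] :: (w'.take j).reverse := by
        rw [List.take_add_one, List.getElem?_eq_getElem hj]; simp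
      convert h using 2
      · simp
      · rw [htake]
        funext k
        by_cases e₁ : k = i
        · subst e₁; simp
        · by_cases e₂ : k = i + 1
          · subst e₂; simp
          · simp [e₁, e₂]
    · change (Function.update (β := fun k => List (tm.Γ k)) (fun _ => []) tm.k₁
        ((w'.drop w'.length).map e₁.symm) tm.k₁).head?.isSome = false
      simp
  · obtain ⟨m, hm⟩ : ∃ m, w.length - j = m + 1 := ⟨w.length - j - 1, by omega⟩
    change (Function.update (Function.update r i []) (i + 1)
      (w.take (w.length - j)).reverse (i + 1)).head?.isSome = true
    rw [Function.update_self, hm, List.take_add_one, List.getElem?_eq_getElem (by omega)]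
    simp [show w ≠ [] by rintro rfl; simp at hj]
  · obtain ⟨m, hm⟩ : ∃ m, w.length - j = m + 1 := ⟨w.length - j - 1, by omega⟩
    have hm' : w.length - (j + 1) = m := by omega
    have hml : m < w.length := by omega
    have htake : (w.take (m + 1)).reverse = w[m] :: (w.take m).reverse := by
      rw [List.take_add_one, List.getElem?_eq_getElem hml]; simp
    simp only [hm, hm', htake]
    have h := runs_feedOne e₀ (i + 1) (Function.update (fun _ => []) tm.k₀
      ((w.drop (m + 1)).map e₀.symm)) (Function.update (Function.update r i []) (i + 1)
      (w[m] :: (w.take m).reverse)) (a := w[m]) (l := (w.take m).reverse) (by simp)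
    convert h using 2
    · rw [List.drop_eq_getElem_cons hml, List.map_cons, Function.update_self, Function.update_idem]
    · simp
  · change (Function.update (Function.update r i []) (i + 1)
      (w.take (w.length - w.length)).reverse (i + 1)).head?.isSome = false
    simp

end RegFrag

/-- The query is written to scratch and replaced there by the reversed answer; the final move to the
output register restores the order. The bound `q` on the answer supplies the length bound that
`PolyTime` contains and the cost of the transfers. -/
theorem PolyTime.oracle {α β : Type} {ea : α → List Γ'} {eb : β → List Γ'} {g : α → β}
    (h : TM2ComputableInPolyTime ea eb g) {X : Type} {C : RegContext X} {a : X → α}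
    (ha : PolyTime h.tm C fun x => ea (a x)) {q : Polynomial ℕ}
    (hq : ∀ y, (eb (g y)).length ≤ q.eval (ea y).length) :
    PolyTime h.tm C fun x => eb (g (a x)) := by
  obtain ⟨F, p, ha⟩ := ha.place (C.n + 1) (C.n + 2) (by omega) (by omega)
  refine ⟨(F.seq (RegFrag.call h.inputAlphabet h.outputAlphabet (C.n + 1))).seq
    (RegFrag.move (C.n + 1) C.n), 5 * p + 4 * q.comp p + h.time.comp p + 4, fun x => ?_⟩
  have hp := (ha x).1
  have hb : (eb (g (a x))).length ≤ (q.comp p).eval (C.sz x) := by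
    rw [Polynomial.eval_comp]
    exact (hq (a x)).trans (natPolynomial_eval_mono q hp)
  have ht : h.time.eval (ea (a x)).length ≤ (h.time.comp p).eval (C.sz x) := by
    rw [Polynomial.eval_comp]
    exact natPolynomial_eval_mono h.time hp
  refine ⟨?_, fun r hr hr' => ?_⟩
  · simp only [Polynomial.eval_add, Polynomial.eval_mul, Polynomial.eval_ofNat]
    omega
  · have h₁ := (ha x).2 r hr (fun i hi => hr' i (by omega))
    rw [hr' (C.n + 1) (by omega), List.append_nil] at h₁
    have h₂ := RegFrag.Runs.call (h.outputsFun (a x))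
      (r := Function.update r (C.n + 1) (ea (a x))) (i := C.n + 1) (by simp) (by simp [hr'])
    have h₃ := RegFrag.Runs.move (tm := h.tm) (show C.n + 1 ≠ C.n by omega)
      (Function.update (Function.update r (C.n + 1) (ea (a x))) (C.n + 1) (eb (g (a x))).reverse)
    refine ((h₁.seq h₂).seq h₃).cast ?_ ?_
    · simp only [Polynomial.eval_add, Polynomial.eval_mul, Polynomial.eval_ofNat,
        Function.update_self, List.length_reverse]
      omega
    · funext k
      by_cases e₁ : k = C.n + 1
      · subst e₁; simp [hr']
      · by_cases e₂ : k = C.n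
        · subst e₂; simp
        · simp [e₁, e₂]

/-! ### From fragments to machines -/

section Finite

theorem TM2Stmt.exists_usesIn_lt {tm : FinTM2} {Λ σ : Type} (q : TM2.Stmt (RegΓ tm) Λ σ) :
    ∃ R, TM2Stmt.UsesIn {k | ∀ i, k = .inr i → i < R} q := by
  have mono : ∀ {R R' : ℕ} {q : TM2.Stmt (RegΓ tm) Λ σ}, R ≤ R' →
      TM2Stmt.UsesIn {k | ∀ i, k = .inr i → i < R} q →
      TM2Stmt.UsesIn {k | ∀ i, k = .inr i → i < R'} q :=
    fun h hq => hq.mono fun k hk i hi => (hk i hi).trans_le h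
  have key : ∀ k : tm.K ⊕ ℕ, ∃ R, ∀ i, k = .inr i → i < R := by
    rintro (k | k)
    · exact ⟨0, by simp⟩
    · exact ⟨k + 1, by rintro i ⟨⟩; omega⟩
  induction q with
  | push k f q ih | peek k f q ih | pop k f q ih =>
    obtain ⟨R, hR⟩ := ih
    obtain ⟨R', hR'⟩ := key k
    exact ⟨max R R', fun i hi => (hR' i hi).trans_le (le_max_right _ _), mono (le_max_left _ _) hR⟩
  | load f q ih => exact ih
  | branch f q₁ q₂ ih₁ ih₂ =>
    obtain ⟨R₁, h₁⟩ := ih₁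
    obtain ⟨R₂, h₂⟩ := ih₂
    exact ⟨max R₁ R₂, mono (le_max_left _ _) h₁, mono (le_max_right _ _) h₂⟩
  | goto => exact ⟨0, trivial⟩
  | halt => exact ⟨0, trivial⟩

/-- There are finitely many labels, and each statement mentions finitely many registers. This is
what allows passing to `FinTM2`, whose stacks are finite in number. -/
theorem RegFrag.exists_usesIn_lt {tm : FinTM2} (F : RegFrag tm) :
    ∃ R, ∀ l, TM2Stmt.UsesIn {k | ∀ i, k = .inr i → i < R} (F.code l) := by
  choose R hR using fun l => TM2Stmt.exists_usesIn_lt (F.code l)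
  refine ⟨Finset.univ.sup R, fun l => (hR l).mono fun k hk i hi => (hk i hi).trans_le ?_⟩
  exact Finset.le_sup (Finset.mem_univ l)

/-- The machine that runs a fragment on finitely many registers; the input is in register `0`, the
output in register `1`. -/
def RegFrag.toFinTM2 {tm : FinTM2} (F : RegFrag tm) (R : ℕ) : FinTM2 :=
  letI := tm.kFin
  letI := tm.σFin
  { K := tm.K ⊕ Fin (R + 2)
    k₀ := .inr 0
    k₁ := .inr 1
    Γ := Sum.elim tm.Γ fun _ => Γ'
    Λ := F.Λ
    main := F.main
    σ := tm.σ × Option Γ'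
    initialState := RegFrag.idle tm
    Γk₀Fin := inferInstanceAs (Fintype Γ')
    m := fun l => TM2Stmt.embed (Γ := RegΓ tm) (Γ' := Sum.elim tm.Γ fun _ : Fin (R + 2) => Γ')
      (Sum.map id (Fin.ofNat (R + 2)))
      (fun | .inl _ => Equiv.refl _ | .inr _ => Equiv.refl _) id id (F.code l) }

/-- Register indices are reduced modulo `R + 2`, which is injective on the registers in use. The
summand `2` guarantees that the input and output registers `0` and `1` exist. -/
theorem RegFrag.Runs.toFinTM2 {tm : FinTM2} {F : RegFrag tm} {R : ℕ}
    (hR : ∀ l, TM2Stmt.UsesIn {k | ∀ i, k = .inr i → i < R} (F.code l)) {t : ℕ} {w w' : List Γ'}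
    (h : F.Runs t (Function.update (fun _ => []) 0 w) (Function.update (fun _ => []) 1 w')) :
    Nonempty (TM2OutputsInTime (F.toFinTM2 R) w (some w') t) := by
  obtain ⟨n, hn, h⟩ := h
  refine ⟨⟨n, ?_⟩, hn⟩
  refine stepsTo_iff_iterate.1 ?_
  refine (RegFrag.initList_eq (tm := F.toFinTM2 R) w) ▸
    (RegFrag.haltList_eq (tm := F.toFinTM2 R) w') ▸ ?_
  have hR' : ∀ l, TM2Stmt.UsesIn {k | ∀ i, k = .inr i → i < R + 2} (F.code l) :=
    fun l => (hR l).mono fun k hk i hi => (hk i hi).trans (by omega)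
  have hinj : Set.InjOn (Sum.map id (Fin.ofNat (R + 2)) : tm.K ⊕ ℕ → tm.K ⊕ Fin (R + 2))
      {k | ∀ i, k = .inr i → i < R + 2} := by
    rintro (k | i) hi (k' | j) hj h
    · simpa using h
    · cases h
    · cases h
    · have hi := hi i rfl
      have hj := hj j rfl
      have := congrArg Fin.val (Sum.inr.inj h)
      simp only [Fin.ofNat, Nat.mod_eq_of_lt hi, Nat.mod_eq_of_lt hj] at this
      rw [this]
  have hval : ∀ (m : Fin (R + 2)) (v : List Γ') (i : ℕ), i < R + 2 →
      Function.update (β := fun k => List ((F.toFinTM2 R).Γ k)) (fun _ => []) (.inr m) v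
        (.inr (Fin.ofNat (R + 2) i)) = Function.update (fun _ => []) m.val v i := by
    intro m v i hi
    by_cases e : i = m.val
    · have : Fin.ofNat (R + 2) i = m := Fin.ext (by simp [e])
      rw [this]
      subst e
      exact (Function.update_self (β := fun k => List ((F.toFinTM2 R).Γ k)) _ _ _).trans
        (Function.update_self (β := fun _ => List Γ') m.val v fun _ => []).symm
    · have : Fin.ofNat (R + 2) i ≠ m := fun h => e (by
        have := congrArg Fin.val h
        simpa [Nat.mod_eq_of_lt hi] using this)
      rw [Function.update_of_ne e]
      exact Function.update_of_ne (fun h => this (Sum.inr.inj h)) _ _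
  have hcopy : StackCopy (Γ := RegΓ tm) (Γ' := Sum.elim tm.Γ fun _ : Fin (R + 2) => Γ')
      {k | ∀ i, k = .inr i → i < R + 2} (Sum.map id (Fin.ofNat (R + 2)))
      (fun | .inl _ => Equiv.refl _ | .inr _ => Equiv.refl _)
      (Function.update (β := fun k => List ((F.toFinTM2 R).Γ k)) (fun _ => []) (.inr 0) w)
      (regStacks tm (Function.update (fun _ => []) 0 w))
      (Function.update (β := fun k => List ((F.toFinTM2 R).Γ k)) (fun _ => []) (.inr 0) w) := by
    refine ⟨fun k hk => ?_, fun _ _ => rfl⟩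
    rcases k with k | i
    · rfl
    · exact (hval 0 w i (hk i rfl)).trans (List.map_id _).symm
  obtain ⟨S, hS, hS'⟩ := hcopy.stepsTo (get := id) (put := id) hinj (fun _ => rfl) hR' h
  have hS₁ : Function.update (β := fun k => List ((F.toFinTM2 R).Γ k)) (fun _ => []) (.inr 1) w'
      = S := by
    funext k
    rcases k with k | i
    · exact (hS'.1 (.inl k) (by simp)).symm
    · have h₁ := hS'.1 (.inr i.val) (fun j hj => by cases hj; exact i.isLt)
      have h₂ := (hval 1 w' i i.isLt)
      have hi : Fin.ofNat (R + 2) i.val = i := Fin.ext (by simp)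
      have h₃ := (h₁.trans (List.map_id _)).symm
      simp only [Sum.map_inr] at h₃
      rw [hi] at h₂ h₃
      exact h₂.trans h₃
  exact hS₁ ▸ hS

/-- A single register holding the encoding of the parameter. -/
def RegContext.base {X : Type} (e : X → List Γ') : RegContext X where
  n := 1
  env _ := e
  sz x := (e x).length
  bound := ⟨.X, by simp⟩

theorem PolyTime.toTM2 {tm : FinTM2} {X : Type} {e f : X → List Γ'}
    (h : PolyTime tm (RegContext.base e) f) :
    Nonempty (TM2ComputableInPolyTime e (id : List Γ' → List Γ') f) := by
  obtain ⟨F, p, h⟩ := h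
  -- A halting configuration must have every stack except the output empty, so the input is erased
  -- at the end.
  obtain ⟨R, hR⟩ := RegFrag.exists_usesIn_lt (F.seq (RegFrag.clear 0))
  refine ⟨⟨⟨(RegFrag.toFinTM2 (F.seq (RegFrag.clear 0)) R), Equiv.refl Γ', Equiv.refl Γ'⟩,
    p + 2 * .X + 1, fun x => Classical.choice ?_⟩⟩
  have h₁ := (h x).2 (Function.update (fun _ => []) 0 (e x))
    (fun i hi => by
      have : i = 0 := by simpa [RegContext.base] using hi
      subst this; simp [RegContext.base])
    (fun i hi => by
      rw [Function.update_of_ne (by simp only [RegContext.base] at hi; omega)])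
  have h₂ := RegFrag.Runs.clear (tm := tm) 0 (Function.update (Function.update (fun _ => []) 0
    (e x)) 1 (f x))
  simp only [RegContext.base] at h₁
  rw [Function.update_of_ne (by omega), List.append_nil] at h₁
  have h₃ := ((h₁.seq h₂).cast (t' := (p + 2 * .X + 1).eval (e x).length)
    (r'' := Function.update (fun _ => []) 1 (f x)) ?_ ?_).toFinTM2 hR
  · have H : ∀ w w' : List Γ', w = e x → w' = f x → Nonempty (TM2OutputsInTime
        (RegFrag.toFinTM2 (F.seq (RegFrag.clear 0)) R) w (some w')
        ((p + 2 * .X + 1).eval (e x).length)) := by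
      rintro _ _ rfl rfl
      exact h₃
    exact H _ _ (List.map_id _) (List.map_id _)
  · simp
    omega
  · funext k
    by_cases e₁ : k = 0
    · subst e₁; simp
    · by_cases e₂ : k = 1
      · subst e₂; simp
      · simp [e₁, e₂]

end Finite

/-! ### Numbers and predicates computable in polynomial time -/

/-- The number `a x` is computable in unary in polynomial time. -/
def PolyNat (tm : FinTM2) {X : Type} (C : RegContext X) (a : X → ℕ) : Prop :=
  PolyTime tm C fun x => List.replicate (a x) tick

open Classical in
/-- The predicate `P` is decidable in polynomial time. -/
def PolyPred (tm : FinTM2) {X : Type} (C : RegContext X) (P : X → Prop) : Prop :=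
  PolyTime tm C fun x => if P x then [tick] else []

theorem flatMap_range_singleton {α : Type} (n : ℕ) (a : α) :
    ((List.range n).flatMap fun _ => [a]) = List.replicate n a := by
  induction n with
  | zero => rfl
  | succ n ih => simp [List.range_succ, ih, List.replicate_succ']

open Classical in
theorem flatMap_range_ite {α : Type} (n : ℕ) (a : α) (P : ℕ → Prop) :
    ((List.range n).flatMap fun i => if P i then [a] else []) =
      List.replicate ((Finset.range n).filter P).card a := by
  induction n with
  | zero => rfl
  | succ n ih =>
    rw [List.range_succ, List.flatMap_append, ih, Finset.range_add_one, Finset.filter_insert]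
    by_cases h : P n
    · rw [if_pos h, Finset.card_insert_of_notMem (by simp)]
      simp [h, List.replicate_succ']
    · simp [h]

section Calculus

variable {tm : FinTM2} {X : Type} {C : RegContext X}

theorem PolyTime.congr {f g : X → List Γ'} (hf : PolyTime tm C f) (h : ∀ x, g x = f x) :
    PolyTime tm C g := by
  rwa [show g = f from funext h]

theorem PolyNat.congr {a b : X → ℕ} (ha : PolyNat tm C a) (h : ∀ x, b x = a x) :
    PolyNat tm C b := by
  rwa [show b = a from funext h]

theorem PolyPred.congr {P Q : X → Prop} (hP : PolyPred tm C P) (h : ∀ x, Q x ↔ P x) :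
    PolyPred tm C Q := by
  rwa [show Q = P from funext fun x => propext (h x)]

theorem PolyNat.weaken {a : X → ℕ} (ha : PolyNat tm C a) : PolyNat tm C.index fun p => a p.1 :=
  PolyTime.weaken ha

theorem PolyNat.index : PolyNat tm C.index fun p => p.2 := PolyTime.indexVar

theorem PolyTime.word (w : List Γ') : PolyTime tm C fun _ => w := by
  induction w with
  | nil => exact .nil
  | cons a w ih => exact (PolyTime.symbol a).append ih

open Classical in
theorem PolyTime.ite {P : X → Prop} {f g : X → List Γ'} (hP : PolyPred tm C P)
    (hf : PolyTime tm C f) (hg : PolyTime tm C g) :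
    PolyTime tm C fun x => if P x then f x else g x :=
  (PolyTime.iteHead hP Option.isSome hf hg).congr fun x => by by_cases h : P x <;> simp [h]

theorem PolyTime.flatMapRange {n : X → ℕ} {g : X × ℕ → List Γ'} (hn : PolyNat tm C n)
    (hg : PolyTime tm C.index g) :
    PolyTime tm C fun x => (List.range (n x)).flatMap fun i => g (x, i) :=
  (PolyTime.flatMap hn hg).congr fun _ => by simp

theorem PolyTime.replicate {n : X → ℕ} (hn : PolyNat tm C n) (a : Γ') :
    PolyTime tm C fun x => List.replicate (n x) a :=
  (PolyTime.flatMapRange hn (.symbol a)).congr fun _ => (flatMap_range_singleton _ _).symm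

theorem PolyNat.const (n : ℕ) : PolyNat tm C fun _ => n := PolyTime.word _

theorem PolyNat.length {f : X → List Γ'} (hf : PolyTime tm C f) :
    PolyNat tm C fun x => (f x).length :=
  (PolyTime.flatMap hf (.symbol tick)).congr fun _ => (flatMap_range_singleton _ _).symm

theorem PolyNat.add {a b : X → ℕ} (ha : PolyNat tm C a) (hb : PolyNat tm C b) :
    PolyNat tm C fun x => a x + b x :=
  (PolyTime.append ha hb).congr fun x => by simp

theorem PolyNat.mul {a b : X → ℕ} (ha : PolyNat tm C a) (hb : PolyNat tm C b) :
    PolyNat tm C fun x => a x * b x :=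
  (PolyNat.length (PolyTime.flatMapRange ha hb.weaken)).congr fun _ => by simp

theorem PolyPred.not {P : X → Prop} (hP : PolyPred tm C P) : PolyPred tm C fun x => ¬P x :=
  (PolyTime.ite hP .nil (.symbol tick)).congr fun x => by by_cases h : P x <;> simp [h]

theorem PolyPred.and {P Q : X → Prop} (hP : PolyPred tm C P) (hQ : PolyPred tm C Q) :
    PolyPred tm C fun x => P x ∧ Q x :=
  (PolyTime.ite hP hQ .nil).congr fun x => by
    by_cases h : P x <;> by_cases h' : Q x <;> simp [h, h']

theorem PolyPred.or {P Q : X → Prop} (hP : PolyPred tm C P) (hQ : PolyPred tm C Q) :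
    PolyPred tm C fun x => P x ∨ Q x :=
  (PolyTime.ite hP (.symbol tick) hQ).congr fun x => by
    by_cases h : P x <;> by_cases h' : Q x <;> simp [h, h']

theorem PolyPred.imp {P Q : X → Prop} (hP : PolyPred tm C P) (hQ : PolyPred tm C Q) :
    PolyPred tm C fun x => P x → Q x :=
  (hP.not.or hQ).congr fun _ => imp_iff_not_or

/-- A unary word of length `a` has no symbol at position `b` exactly when `a ≤ b`. The other
comparisons are derived from this one. -/
theorem PolyPred.le {a b : X → ℕ} (ha : PolyNat tm C a) (hb : PolyNat tm C b) :
    PolyPred tm C fun x => a x ≤ b x :=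
  (PolyTime.iteHead (PolyTime.get ha hb) Option.isNone (.symbol tick) .nil).congr fun x => by
    by_cases h : a x ≤ b x
    · simp [h]
    · have h' : b x < a x := not_le.1 h
      simp [h']

theorem PolyPred.lt {a b : X → ℕ} (ha : PolyNat tm C a) (hb : PolyNat tm C b) :
    PolyPred tm C fun x => a x < b x :=
  (PolyPred.le hb ha).not.congr fun _ => not_le.symm

theorem PolyPred.eq {a b : X → ℕ} (ha : PolyNat tm C a) (hb : PolyNat tm C b) :
    PolyPred tm C fun x => a x = b x :=
  ((PolyPred.le ha hb).and (PolyPred.le hb ha)).congr fun _ => le_antisymm_iff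

theorem PolyPred.getElem? {f : X → List Γ'} {a : X → ℕ} (hf : PolyTime tm C f)
    (ha : PolyNat tm C a) (c : Γ') : PolyPred tm C fun x => (f x)[a x]? = some c :=
  (PolyTime.iteHead (PolyTime.get hf ha) (fun o => decide (o = some c)) (.symbol tick)
    .nil).congr fun x => by simp

theorem PolyNat.card {n : X → ℕ} {P : X × ℕ → Prop} [∀ x, DecidablePred fun i => P (x, i)]
    (hn : PolyNat tm C n) (hP : PolyPred tm C.index P) :
    PolyNat tm C fun x => ((Finset.range (n x)).filter fun i => P (x, i)).card :=
  (PolyTime.flatMapRange hn hP).congr fun x => by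
    classical
    rw [flatMap_range_ite]
    congr!

theorem PolyPred.exists_lt {n : X → ℕ} {P : X × ℕ → Prop} (hn : PolyNat tm C n)
    (hP : PolyPred tm C.index P) : PolyPred tm C fun x => ∃ i < n x, P (x, i) := by
  classical
  refine (PolyPred.lt (.const 0) (PolyNat.card hn hP)).congr fun x => ?_
  rw [Finset.card_pos]
  constructor
  · rintro ⟨i, hi, h⟩
    exact ⟨i, by simp [hi, h]⟩
  · rintro ⟨i, hi⟩
    simpa using ⟨i, by simpa using hi⟩

theorem PolyPred.forall_lt {n : X → ℕ} {P : X × ℕ → Prop} (hn : PolyNat tm C n)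
    (hP : PolyPred tm C.index P) : PolyPred tm C fun x => ∀ i < n x, P (x, i) :=
  (PolyPred.exists_lt hn hP.not).not.congr fun x => by push Not; rfl

theorem PolyNat.pred {a : X → ℕ} (ha : PolyNat tm C a) : PolyNat tm C fun x => a x - 1 := by
  classical
  refine (PolyNat.card ha (PolyPred.lt (.const 0) .index)).congr fun x => ?_
  rw [show (Finset.range (a x)).filter (fun i => 0 < i) = Finset.Ico 1 (a x) by
    ext i; simp; omega]
  simp

/-- The prefix of given length. -/
theorem PolyTime.take {f : X → List Γ'} {a : X → ℕ} (hf : PolyTime tm C f) (ha : PolyNat tm C a) :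
    PolyTime tm C fun x => (f x).take (a x) := by
  refine (PolyTime.flatMapRange ha (PolyTime.get hf.weaken PolyNat.index)).congr fun x => ?_
  generalize a x = n
  induction n with
  | zero => rfl
  | succ n ih =>
    simp only [List.length_replicate] at ih ⊢
    simp [List.range_succ, List.take_add_one, ih]

end Calculus

/-! ### Tables -/

theorem flatMap_finRange {α : Type} (n : ℕ) (g : ℕ → List α) :
    ((List.finRange n).flatMap fun i : Fin n => g i) = (List.range n).flatMap g := by
  have h : (List.finRange n).map Fin.val = List.range n := by simp
  rw [← h, List.flatMap_map]

theorem getElem?_flatMap_of_length {α β : Type} {L : ℕ} {l : List α} {g : α → List β}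
    (hg : ∀ a ∈ l, (g a).length = L) (i : ℕ) {j : ℕ} (hj : j < L) :
    (l.flatMap g)[i * L + j]? = l[i]?.bind fun a => (g a)[j]? := by
  induction l generalizing i with
  | nil => simp
  | cons a l ih =>
    have ha := hg a (by simp)
    rw [List.flatMap_cons]
    cases i with
    | zero =>
      rw [Nat.zero_mul, Nat.zero_add, List.getElem?_append_left (by omega)]
      simp
    | succ i =>
      rw [List.getElem?_append_right (by rw [ha, Nat.succ_mul]; omega), ha,
        show (i + 1) * L + j - L = i * L + j by rw [Nat.succ_mul]; omega,
        ih (fun a h => hg a (by simp [h]))]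
      simp

theorem length_encodeTable_singleton {n m : ℕ} (c : Fin n → Fin m → Γ') :
    (encodeTable fun a b => [c a b]).length = n * (m + 1) := by
  simp [encodeTable, List.length_flatMap]

theorem getElem?_encodeTable_singleton {n m : ℕ} (c : Fin n → Fin m → Γ') (a : Fin n) (b : Fin m) :
    (encodeTable fun a b => [c a b])[a.val * (m + 1) + b]? = some (c a b) := by
  rw [encodeTable, getElem?_flatMap_of_length (L := m + 1) (by simp) _ (by omega)]
  have ha : (List.finRange n)[a.val]? = some a := by simp
  rw [ha, Option.bind_some, List.getElem?_append_left (by simp)]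
  have h := getElem?_flatMap_of_length (L := 1) (l := List.finRange m) (g := fun b => [c a b])
    (by simp) b.val (j := 0) (by omega)
  rw [Nat.mul_one, Nat.add_zero] at h
  rw [h]
  simp

/-! ### Reading a bipartite graph -/

namespace BipartiteInstance

/-- Adjacency in terms of natural numbers. -/
def Adj (G : BipartiteInstance) (a b : ℕ) : Prop :=
  ∃ (ha : a < G.N) (hb : b < G.M), ((⟨a, ha⟩, ⟨b, hb⟩) : Fin G.N × Fin G.M) ∈ G.E

theorem getElem?_encode_lt (G : BipartiteInstance) {i : ℕ} (hi : i < G.N) :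
    G.encode[i]? = some tick := by
  simp [encode, encodeUnary, List.getElem?_append, hi]

theorem getElem?_encode_N (G : BipartiteInstance) : G.encode[G.N]? = some Γ'.comma := by
  simp [encode, encodeUnary]

theorem getElem?_encode_right (G : BipartiteInstance) {i : ℕ} (hi : i < G.M) :
    G.encode[G.N + 1 + i]? = some tick := by
  simp [encode, encodeUnary, List.getElem?_append, hi, Nat.add_assoc, Nat.add_comm 1 i]

theorem getElem?_encode_M (G : BipartiteInstance) :
    G.encode[G.N + 1 + G.M]? = some Γ'.comma := by
  simp [encode, encodeUnary, Nat.add_assoc, Nat.add_comm 1 G.M]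

theorem getElem?_encode_table (G : BipartiteInstance) (a : Fin G.N) (b : Fin G.M) :
    G.encode[G.N + 1 + (G.M + 1) + (a * (G.M + 1) + b)]? =
      some (Γ'.bit (decide ((a, b) ∈ G.E))) := by
  have h : (encodeUnary G.N ++ encodeUnary G.M).length = G.N + 1 + (G.M + 1) := by
    simp [encodeUnary]; omega
  rw [encode, List.getElem?_append_right (by omega), h, Nat.add_sub_cancel_left]
  exact getElem?_encodeTable_singleton (fun a b => Γ'.bit (decide ((a, b) ∈ G.E))) a b

theorem length_encode (G : BipartiteInstance) :
    G.encode.length = G.N + 1 + (G.M + 1) + G.N * (G.M + 1) := by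
  rw [encode, List.length_append, length_encodeTable_singleton]
  simp [encodeUnary]
  omega

/-- This expresses `N` by bounded counting and bounded search in the encoding, operations under
which `PolyNat` and `PolyPred` are closed; `card_between_commas` does the same for `M`. -/
theorem card_before_comma (G : BipartiteInstance) :
    ((Finset.range G.encode.length).filter fun i =>
      ¬∃ j < i + 1, G.encode[j]? = some Γ'.comma).card = G.N := by
  rw [show (Finset.range G.encode.length).filter
    (fun i => ¬∃ j < i + 1, G.encode[j]? = some Γ'.comma) = Finset.range G.N from ?_,
    Finset.card_range]
  ext i
  simp only [Finset.mem_filter, Finset.mem_range]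
  constructor
  · rintro ⟨_, h⟩
    by_contra hi
    exact h ⟨G.N, by omega, G.getElem?_encode_N⟩
  · intro hi
    refine ⟨by rw [length_encode]; omega, ?_⟩
    rintro ⟨j, hj, h⟩
    rw [G.getElem?_encode_lt (by omega)] at h
    simp at h

theorem card_between_commas (G : BipartiteInstance) :
    ((Finset.range G.encode.length).filter fun i => G.N < i ∧
      ¬∃ j < i + 1, G.N < j ∧ G.encode[j]? = some Γ'.comma).card = G.M := by
  rw [show (Finset.range G.encode.length).filter (fun i => G.N < i ∧
      ¬∃ j < i + 1, G.N < j ∧ G.encode[j]? = some Γ'.comma) =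
      Finset.Ico (G.N + 1) (G.N + 1 + G.M) from ?_, Nat.card_Ico, Nat.add_sub_cancel_left]
  ext i
  simp only [Finset.mem_filter, Finset.mem_range, Finset.mem_Ico]
  constructor
  · rintro ⟨_, hN, h⟩
    refine ⟨hN, ?_⟩
    by_contra hi
    exact h ⟨G.N + 1 + G.M, by omega, by omega, G.getElem?_encode_M⟩
  · rintro ⟨hN, hi⟩
    refine ⟨by rw [length_encode]; omega, hN, ?_⟩
    rintro ⟨j, hj, hNj, h⟩
    obtain ⟨k, rfl⟩ := Nat.exists_eq_add_of_le (show G.N + 1 ≤ j from hNj)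
    rw [G.getElem?_encode_right (by omega)] at h
    simp at h

/-- The range conditions are part of the test, since a column index out of range could read a cell
of another row. -/
theorem adj_iff (G : BipartiteInstance) (a b : ℕ) :
    G.Adj a b ↔ (a < G.N ∧ b < G.M) ∧
      G.encode[G.N + 1 + (G.M + 1) + (a * (G.M + 1) + b)]? = some tick := by
  constructor
  · rintro ⟨ha, hb, h⟩
    refine ⟨⟨ha, hb⟩, ?_⟩
    rw [G.getElem?_encode_table ⟨a, ha⟩ ⟨b, hb⟩]
    simp [h]
  · rintro ⟨⟨ha, hb⟩, h⟩
    rw [G.getElem?_encode_table ⟨a, ha⟩ ⟨b, hb⟩] at h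
    exact ⟨ha, hb, by simpa using h⟩

end BipartiteInstance

section ReadGraph

variable {tm : FinTM2} {X : Type} {C : RegContext X} {G : X → BipartiteInstance}

theorem PolyNat.graphN (hG : PolyTime tm C fun x => (G x).encode) :
    PolyNat tm C fun x => (G x).N := by
  classical
  refine (PolyNat.card (PolyNat.length hG) (PolyPred.exists_lt (PolyNat.index.add (.const 1))
    (PolyPred.getElem? hG.weaken.weaken .index Γ'.comma)).not).congr fun x => ?_
  exact (G x).card_before_comma.symm

theorem PolyNat.graphM (hG : PolyTime tm C fun x => (G x).encode) :
    PolyNat tm C fun x => (G x).M := by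
  classical
  have hN := PolyNat.graphN hG
  refine (PolyNat.card (PolyNat.length hG) ((PolyPred.lt hN.weaken .index).and
    (PolyPred.exists_lt (PolyNat.index.add (.const 1)) ((PolyPred.lt hN.weaken.weaken .index).and
    (PolyPred.getElem? hG.weaken.weaken .index Γ'.comma))).not)).congr fun x => ?_
  exact (G x).card_between_commas.symm

theorem PolyPred.adj (hG : PolyTime tm C fun x => (G x).encode) {a b : X → ℕ}
    (ha : PolyNat tm C a) (hb : PolyNat tm C b) : PolyPred tm C fun x => (G x).Adj (a x) (b x) := by
  have hN := PolyNat.graphN hG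
  have hM := PolyNat.graphM hG
  exact (((PolyPred.lt ha hN).and (PolyPred.lt hb hM)).and (PolyPred.getElem? hG
    (((hN.add (.const 1)).add (hM.add (.const 1))).add ((ha.mul (hM.add (.const 1))).add hb))
    tick)).congr fun x => (G x).adj_iff _ _

end ReadGraph

/-! ### Splitting an ordered matching into two halves -/

section Halves

/-- An injective rank with values in `1, …, |H|` takes each of these values, and exactly `⌊|H|/2⌋`
of them are at most `|H|/2`. -/
theorem Finset.card_filter_two_mul_le_card {α : Type*} {H : Finset α} {r : α → ℕ}
    (h₁ : ∀ c ∈ H, 1 ≤ r c ∧ r c ≤ H.card) (h₂ : Set.InjOn r H) :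
    (H.filter fun c => r c + r c ≤ H.card).card = H.card / 2 := by
  have himg : H.image r = Finset.Icc 1 H.card := by
    apply Finset.eq_of_subset_of_card_le
    · intro n hn
      obtain ⟨c, hc, rfl⟩ := Finset.mem_image.1 hn
      simpa using h₁ c hc
    · rw [Finset.card_image_of_injOn h₂]; simp
  rw [← Finset.card_image_of_injOn (h₂.mono fun c hc => (Finset.mem_filter.1 hc).1),
    show (H.filter fun c => r c + r c ≤ H.card).image r = Finset.Icc 1 (H.card / 2) from ?_]
  · simp
  · ext n
    have : n ∈ H.image r ↔ n ∈ Finset.Icc 1 H.card := by rw [himg]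
    simp only [Finset.mem_image, Finset.mem_Icc, Finset.mem_filter] at this ⊢
    constructor
    · rintro ⟨c, ⟨hc, hr⟩, rfl⟩
      have := h₁ c hc
      omega
    · rintro ⟨h, h'⟩
      obtain ⟨c, hc, rfl⟩ := this.2 ⟨h, by omega⟩
      exact ⟨c, ⟨hc, by omega⟩, rfl⟩

variable (N M : ℕ) (R D : ℕ → ℕ → Prop)

/-- Agent `a < N` holds house `c < M` according to `R`, and is related by `D` to all houses beyond
`c` that are held by someone. -/
def Good (a c : ℕ) : Prop :=
  R a c ∧ c < M ∧ ∀ a' < N, ∀ c' < M, (c < c' ∧ R a' c') → D a c'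

/-- The house `c` is held by a good agent. -/
def GoodHouse (c : ℕ) : Prop := ∃ a < N, Good N M R D a c

open Classical in
/-- Number of houses held by good agents. -/
noncomputable def goodCount : ℕ := ((Finset.range M).filter fun c => GoodHouse N M R D c).card

open Classical in
/-- Number of houses up to `c` held by good agents. -/
noncomputable def lowerRank (c : ℕ) : ℕ :=
  ((Finset.range M).filter fun c' => GoodHouse N M R D c' ∧ c' ≤ c).card

open Classical in
/-- Number of houses from `c` on held by good agents. -/
noncomputable def upperRank (c : ℕ) : ℕ :=
  ((Finset.range M).filter fun c' => GoodHouse N M R D c' ∧ c ≤ c').card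

/-- The good agents holding a house in the lower half. -/
def LeftHalf (a : ℕ) : Prop :=
  ∃ c < M, Good N M R D a c ∧
    lowerRank N M R D c + lowerRank N M R D c ≤ goodCount N M R D

/-- The houses in the upper half. -/
def RightHalf (c : ℕ) : Prop :=
  GoodHouse N M R D c ∧ upperRank N M R D c + upperRank N M R D c ≤ goodCount N M R D

variable {N M R D}

theorem GoodHouse.lt {c : ℕ} (h : GoodHouse N M R D c) : c < M :=
  let ⟨_, _, h⟩ := h
  h.2.1

open Classical in
theorem card_lowerHalf :
    ((Finset.range M).filter fun c => GoodHouse N M R D c ∧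
      lowerRank N M R D c + lowerRank N M R D c ≤ goodCount N M R D).card =
      goodCount N M R D / 2 := by
  rw [← Finset.filter_filter]
  refine Finset.card_filter_two_mul_le_card (fun c hc => ⟨?_, ?_⟩) ?_
  · refine Finset.card_pos.2 ⟨c, ?_⟩
    simpa using hc
  · refine Finset.card_le_card fun c' hc' => ?_
    simp only [Finset.mem_filter] at hc' ⊢
    exact ⟨hc'.1, hc'.2.1⟩
  · have key : ∀ c c', GoodHouse N M R D c' → c < c' →
        lowerRank N M R D c < lowerRank N M R D c' := by
      intro c c' hc' h
      refine Finset.card_lt_card ((Finset.ssubset_iff_of_subset fun d hd => ?_).2 ⟨c', ?_, ?_⟩)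
      · simp only [Finset.mem_filter] at hd ⊢
        exact ⟨hd.1, hd.2.1, hd.2.2.trans h.le⟩
      · simp [hc', hc'.lt]
      · simp [h]
    intro c hc c' hc' h
    simp only [Finset.coe_filter, Set.mem_ofPred_eq] at hc hc'
    rcases lt_trichotomy c c' with hlt | rfl | hlt
    · exact absurd h (key _ _ hc'.2 hlt).ne
    · rfl
    · exact absurd h (key _ _ hc.2 hlt).ne'

open Classical in
theorem card_rightHalf :
    ((Finset.range M).filter fun c => RightHalf N M R D c).card = goodCount N M R D / 2 := by
  rw [show (Finset.range M).filter (fun c => RightHalf N M R D c) =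
    ((Finset.range M).filter fun c => GoodHouse N M R D c).filter fun c =>
      upperRank N M R D c + upperRank N M R D c ≤ goodCount N M R D by
    ext c
    simp only [Finset.mem_filter, and_assoc]
    rfl]
  refine Finset.card_filter_two_mul_le_card (fun c hc => ⟨?_, ?_⟩) ?_
  · refine Finset.card_pos.2 ⟨c, ?_⟩
    simpa using hc
  · refine Finset.card_le_card fun c' hc' => ?_
    simp only [Finset.mem_filter] at hc' ⊢
    exact ⟨hc'.1, hc'.2.1⟩
  · have key : ∀ c c', GoodHouse N M R D c → c < c' →
        upperRank N M R D c' < upperRank N M R D c := by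
      intro c c' hc h
      refine Finset.card_lt_card ((Finset.ssubset_iff_of_subset fun d hd => ?_).2 ⟨c, ?_, ?_⟩)
      · simp only [Finset.mem_filter] at hd ⊢
        exact ⟨hd.1, hd.2.1, h.le.trans hd.2.2⟩
      · simp [hc, hc.lt]
      · simp [h]
    intro c hc c' hc' h
    simp only [Finset.coe_filter, Set.mem_ofPred_eq] at hc hc'
    rcases lt_trichotomy c c' with hlt | rfl | hlt
    · exact absurd h (key _ _ hc.2 hlt).ne'
    · rfl
    · exact absurd h (key _ _ hc'.2 hlt).ne

open Classical in
-- Sending each house of the lower half to a good holder is a bijection: an agent holds at most one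
-- house, and a house has at most one holder.
theorem card_leftHalf (hR : ∀ a c c', R a c → R a c' → c = c')
    (hR' : ∀ a a' c, R a c → R a' c → a = a') :
    ((Finset.range N).filter fun a => LeftHalf N M R D a).card = goodCount N M R D / 2 := by
  rw [← card_lowerHalf]
  symm
  have hg : ∀ c, ∃ a, GoodHouse N M R D c → a < N ∧ Good N M R D a c := fun c => by
    by_cases h : GoodHouse N M R D c
    · obtain ⟨a, h₁, h₂⟩ := h
      exact ⟨a, fun _ => ⟨h₁, h₂⟩⟩
    · exact ⟨0, fun h' => absurd h' h⟩
  choose g hg using hg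
  refine Finset.card_bij (fun c _ => g c) (fun c hc => ?_) (fun c hc c' hc' h => ?_)
    (fun a ha => ?_)
  · simp only [Finset.mem_filter, Finset.mem_range] at hc ⊢
    exact ⟨(hg c hc.2.1).1, c, hc.1, (hg c hc.2.1).2, hc.2.2⟩
  · simp only [Finset.mem_filter, Finset.mem_range] at hc hc'
    have h₁ := (hg c hc.2.1).2.1
    rw [h] at h₁
    exact hR _ _ _ h₁ (hg c' hc'.2.1).2.1
  · simp only [Finset.mem_filter, Finset.mem_range] at ha
    obtain ⟨haN, c, hcM, hc, hr⟩ := ha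
    have hgood : GoodHouse N M R D c := ⟨a, haN, hc⟩
    refine ⟨c, by simp [hcM, hgood, hr], ?_⟩
    exact hR' _ _ _ (hg c hgood).2.1 hc.1

theorem LeftHalf.rel {a c : ℕ} (ha : LeftHalf N M R D a) (hc : RightHalf N M R D c) : D a c := by
  classical
  obtain ⟨d, hd, had, hr⟩ := ha
  obtain ⟨hgc, hr'⟩ := hc
  obtain ⟨a', ha', hac'⟩ := hgc
  refine had.2.2 a' ha' c hac'.2.1 ⟨?_, hac'.1⟩
  by_contra hcd
  -- If `c ≤ d`, the good houses up to `d` and those from `c` on cover all good houses and share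
  -- `c`. But either rank is at most half of the total.
  have hle : goodCount N M R D + 1 ≤ lowerRank N M R D d + upperRank N M R D c := by
    unfold goodCount lowerRank upperRank
    rw [← Finset.card_union_add_card_inter]
    refine add_le_add (Finset.card_le_card fun b hb => ?_) (Finset.card_pos.2 ⟨c, ?_⟩)
    · simp only [Finset.mem_filter, Finset.mem_union] at hb ⊢
      rcases le_total b d with h | h
      · exact .inl ⟨hb.1, hb.2, h⟩
      · exact .inr ⟨hb.1, hb.2, by omega⟩
    · have : GoodHouse N M R D c := ⟨a', ha', hac'⟩
      simp [this, this.lt, not_lt.1 hcd]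
  omega

/-- Both halves have the same size, so neither is empty alone. A partner in the other half gives
access to those parts of `AdjAvoid` that concern only one of the two vertices. -/
theorem LeftHalf.exists_rightHalf {a : ℕ} (haN : a < N) (ha : LeftHalf N M R D a) :
    ∃ c, RightHalf N M R D c := by
  classical
  obtain ⟨d, hd, had, hr⟩ := ha
  have hgood : GoodHouse N M R D d := ⟨a, haN, had⟩
  have h : 0 < goodCount N M R D / 2 := by
    rw [← card_lowerHalf]
    exact Finset.card_pos.2 ⟨d, by simp [hd, hgood, hr]⟩
  rw [← card_rightHalf] at h
  obtain ⟨c, hc⟩ := Finset.card_pos.1 h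
  exact ⟨c, (Finset.mem_filter.1 hc).2⟩

theorem RightHalf.exists_leftHalf {c : ℕ} (hc : RightHalf N M R D c) :
    ∃ a < N, LeftHalf N M R D a := by
  classical
  have h : 0 < goodCount N M R D / 2 := by
    rw [← card_rightHalf]
    exact Finset.card_pos.2 ⟨c, by simp [hc, hc.1.lt]⟩
  rw [← card_lowerHalf] at h
  obtain ⟨d, hd⟩ := Finset.card_pos.1 h
  obtain ⟨hd, ⟨a, ha, hg⟩, hr⟩ := Finset.mem_filter.1 hd
  exact ⟨a, ha, d, by simpa using hd, hg, hr⟩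

end Halves

/-! ### The house allocation instance of an edge -/

theorem Fin.card_filter_val {n : ℕ} (P : ℕ → Prop) [DecidablePred P] :
    ((Finset.univ : Finset (Fin n)).filter fun i => P i.val).card =
      ((Finset.range n).filter P).card := by
  rw [← Finset.card_map Fin.valEmbedding]
  congr 1
  ext i
  simp only [Finset.mem_map, Finset.mem_filter, Finset.mem_univ, true_and, Finset.mem_range,
    Fin.valEmbedding_apply]
  exact ⟨by rintro ⟨j, hj, rfl⟩; exact ⟨j.isLt, hj⟩, fun h => ⟨⟨i, h.1⟩, h.2, rfl⟩⟩

namespace BipartiteInstance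

variable (G : BipartiteInstance)

/-- Adjacency in the common neighbourhood of the ends of the edge `(i₀, j₀)`. -/
def AdjAvoid (i₀ j₀ a b : ℕ) : Prop :=
  G.Adj a b ∧ G.Adj a j₀ ∧ G.Adj i₀ b ∧ a ≠ i₀ ∧ b ≠ j₀

open Classical in
/-- The value of house `h` for agent `a`: houses `h ≥ M` have no value, neighbours have value `1`,
and other right vertices have distinct larger values. -/
noncomputable def houseValue (i₀ j₀ a h : ℕ) : ℚ≥0 :=
  if G.M ≤ h then 0 else if G.AdjAvoid i₀ j₀ a h then 1 else 2 ^ (h + 1)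

/-- The left vertices are agents, the right vertices are houses, and there are `N - 1` further
houses of no value. -/
noncomputable def toHouse (i₀ j₀ : ℕ) : HouseInstance where
  n := G.N
  m := G.M - 1 + G.N
  n_le_m := by omega
  u a h := G.houseValue i₀ j₀ a h

variable {G} {i₀ j₀ : ℕ}

/-- Agent `a` holds house `h` in the assignment `φ`. -/
def Held {I : HouseInstance} (φ : I.Assignment) (a h : ℕ) : Prop :=
  ∃ ha : a < I.n, (φ ⟨a, ha⟩).val = h

theorem Held.right_unique {I : HouseInstance} {φ : I.Assignment} {a c c' : ℕ} (h : Held φ a c)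
    (h' : Held φ a c') : c = c' := by
  obtain ⟨_, rfl⟩ := h
  obtain ⟨_, rfl⟩ := h'
  rfl

theorem Held.left_unique {I : HouseInstance} {φ : I.Assignment} {a a' c : ℕ} (h : Held φ a c)
    (h' : Held φ a' c) : a = a' := by
  obtain ⟨h₁, rfl⟩ := h
  obtain ⟨h₂, h₃⟩ := h'
  exact (Fin.mk.inj (φ.injective (Fin.ext h₃))).symm

theorem houseValue_of_le {a h : ℕ} (hh : G.M ≤ h) : G.houseValue i₀ j₀ a h = 0 := by
  simp [houseValue, hh]

theorem houseValue_of_adj {a h : ℕ} (hh : h < G.M) (ha : G.AdjAvoid i₀ j₀ a h) :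
    G.houseValue i₀ j₀ a h = 1 := by
  simp [houseValue, hh, ha]

theorem houseValue_of_not_adj {a h : ℕ} (hh : h < G.M) (ha : ¬G.AdjAvoid i₀ j₀ a h) :
    G.houseValue i₀ j₀ a h = 2 ^ (h + 1) := by
  simp [houseValue, hh, ha]

theorem houseValue_pos {a h : ℕ} (hh : h < G.M) : 0 < G.houseValue i₀ j₀ a h := by
  by_cases ha : G.AdjAvoid i₀ j₀ a h
  · rw [houseValue_of_adj hh ha]; exact one_pos
  · rw [houseValue_of_not_adj hh ha]; positivity

theorem houseValue_lt {a h h' : ℕ} (hh : h < h') (hh' : h' < G.M)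
    (ha : ¬G.AdjAvoid i₀ j₀ a h') : G.houseValue i₀ j₀ a h < G.houseValue i₀ j₀ a h' := by
  rw [houseValue_of_not_adj hh' ha]
  by_cases ha' : G.AdjAvoid i₀ j₀ a h
  · rw [houseValue_of_adj (hh.trans hh') ha']
    exact one_lt_pow₀ (by norm_num) (by omega)
  · rw [houseValue_of_not_adj (hh.trans hh') ha']
    exact pow_lt_pow_right₀ (by norm_num) (by omega)

/-- Somebody holds a right vertex, which every agent values positively, so an envy-free agent cannot
hold a worthless house. Any later held right vertex unrelated to it would be strictly dearer than
its own house. -/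
theorem good_of_isEnvyFree (hM : 0 < G.M) {φ : (G.toHouse i₀ j₀).Assignment}
    {a : Fin (G.toHouse i₀ j₀).n} (ha : (G.toHouse i₀ j₀).IsEnvyFree φ a) :
    Good G.N G.M (Held φ) (G.AdjAvoid i₀ j₀) a (φ a) := by
  replace ha : ∀ b, G.houseValue i₀ j₀ a (φ b) ≤ G.houseValue i₀ j₀ a (φ a) := ha
  have hlt : (φ a).val < G.M := by
    obtain ⟨b, hb⟩ : ∃ b, (φ b).val < G.M := by
      by_contra hcon
      push Not at hcon
      -- Pigeonhole: otherwise all `N` agents would hold different worthless houses, of which there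
      -- are `N - 1`.
      have hinj : Function.Injective fun b : Fin (G.toHouse i₀ j₀).n =>
          (⟨(φ b).val - G.M, by
            have h₁ : (φ b).val < G.M - 1 + G.N := (φ b).isLt
            have := hcon b
            omega⟩ : Fin (G.N - 1)) := by
        intro b b' h
        have := Fin.mk.inj h
        have := hcon b
        have := hcon b'
        exact φ.injective (Fin.ext (by omega))
      have hcard := Fintype.card_le_of_injective _ hinj
      simp only [Fintype.card_fin] at hcard
      have h₁ : a.val < G.N := a.isLt
      have h₂ : G.N ≤ G.N - 1 := hcard
      omega
    by_contra hge
    have h₁ := ha b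
    rw [houseValue_of_le (not_lt.1 hge)] at h₁
    exact absurd (houseValue_pos hb) (not_lt.2 h₁)
  refine ⟨⟨a.isLt, rfl⟩, hlt, ?_⟩
  rintro a' _ c' hc' ⟨hlt', h, rfl⟩
  by_contra hadj
  exact absurd (ha ⟨a', h⟩) (not_le.2 (houseValue_lt hlt' hc' hadj))

/-- This replaces envy-freeness by a condition on adjacency and order alone, so the utilities play
no role in extracting the biclique. -/
theorem val_le_goodCount (hM : 0 < G.M) (φ : (G.toHouse i₀ j₀).Assignment) :
    (G.toHouse i₀ j₀).val φ ≤ goodCount G.N G.M (Held φ) (G.AdjAvoid i₀ j₀) := by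
  classical
  refine Finset.card_le_card_of_injOn (fun a => (φ a).val) (fun a ha => ?_)
    (fun a _ b _ h => φ.injective (Fin.ext h))
  have hg := good_of_isEnvyFree hM (Finset.mem_filter.1 ha).2
  simp only [Finset.coe_filter, Set.mem_ofPred_eq, Finset.mem_range]
  exact ⟨hg.2.1, a, a.isLt, hg⟩

/-- Remove the edge from the biclique, match the remaining two sides, and give worthless houses to
all other agents. For a matched agent all held right vertices are worth `1` and all other held
houses `0`, so there is nothing to envy. -/
theorem le_opt_toHouse {S : Finset (Fin G.N)} {T : Finset (Fin G.M)}
    (h : G.IsBalancedBiclique S T) {i : Fin G.N} {j : Fin G.M} (hi : i ∈ S) (hj : j ∈ T) :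
    S.card ≤ (G.toHouse i j).opt + 1 := by
  classical
  have hcS := Finset.card_erase_of_mem hi
  have hcT := Finset.card_erase_of_mem hj
  set S' := S.erase i
  set T' := T.erase j
  -- At least one agent must be matched: otherwise the `N - 1` worthless houses would not suffice
  -- for the rest.
  by_cases hS : S'.card = 0
  · omega
  have hcard : S'.card = T'.card := by have := h.1; omega
  let e := Finset.equivOfCardEq hcard
  obtain ⟨g⟩ : Nonempty ({a // a ∉ S'} ↪ Fin (G.N - 1)) := by
    apply Function.Embedding.nonempty_of_card_le
    rw [Fintype.card_subtype_compl, Fintype.card_coe]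
    simp only [Fintype.card_fin]
    omega
  have hM : 0 < G.M := j.pos
  obtain ⟨f, hf₁, hf₂⟩ : ∃ f : Fin G.N → Fin (G.M - 1 + G.N),
      (∀ a (ha : a ∈ S'), (f a).val = (e ⟨a, ha⟩).val.val) ∧
      ∀ a (ha : a ∉ S'), (f a).val = G.M + (g ⟨a, ha⟩).val := by
    refine ⟨fun a => if ha : a ∈ S' then ⟨(e ⟨a, ha⟩).val, ?_⟩ else ⟨G.M + (g ⟨a, ha⟩).val, ?_⟩,
      fun a ha => by simp [ha], fun a ha => by simp [ha]⟩
    · have := (e ⟨a, ha⟩).val.isLt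
      have := a.isLt
      omega
    · have := (g ⟨a, ha⟩).isLt
      omega
  have hf : Function.Injective f := by
    intro a b hab
    replace hab := congrArg Fin.val hab
    by_cases ha : a ∈ S' <;> by_cases hb : b ∈ S'
    · rw [hf₁ a ha, hf₁ b hb] at hab
      exact congrArg Subtype.val (e.injective (Subtype.ext (Fin.ext hab)))
    · rw [hf₁ a ha, hf₂ b hb] at hab
      have := (e ⟨a, ha⟩).val.isLt
      omega
    · rw [hf₂ a ha, hf₁ b hb] at hab
      have := (e ⟨b, hb⟩).val.isLt
      omega
    · rw [hf₂ a ha, hf₂ b hb] at hab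
      exact congrArg Subtype.val (g.injective (Fin.ext (Nat.add_left_cancel hab)))
  let φ : (G.toHouse i j).Assignment := ⟨f, hf⟩
  have hfree : ∀ a ∈ S', (G.toHouse i j).IsEnvyFree φ a := by
    intro a ha
    have hadj : ∀ c ∈ T', G.AdjAvoid i j a c := by
      intro c hc
      have ha₁ := Finset.mem_erase.1 ha
      have hc₁ := Finset.mem_erase.1 hc
      refine ⟨⟨a.isLt, c.isLt, h.2 a ha₁.2 c hc₁.2⟩, ⟨a.isLt, j.isLt, h.2 a ha₁.2 j hj⟩,
        ⟨i.isLt, c.isLt, h.2 i hi c hc₁.2⟩, fun h => ha₁.1 (Fin.ext h), fun h => hc₁.1 (Fin.ext h)⟩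
    have hone : ∀ b ∈ S', G.houseValue i j a (f b) = 1 := by
      intro b hb
      rw [hf₁ b hb]
      exact houseValue_of_adj (e ⟨b, hb⟩).val.isLt (hadj _ (e ⟨b, hb⟩).property)
    intro b
    change G.houseValue i j a (f b) ≤ G.houseValue i j a (f a)
    rw [hone a ha]
    by_cases hb : (show Fin G.N from b) ∈ S'
    · exact (hone b hb).le
    · rw [houseValue_of_le (by rw [hf₂ b hb]; omega)]
      exact zero_le_one
  have hle : S'.card ≤ (G.toHouse i j).val φ :=
    Finset.card_le_card_of_injOn (t := Finset.univ.filter ((G.toHouse i j).IsEnvyFree φ))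
      (fun a : Fin G.N => a) (fun a ha =>
        Finset.mem_coe.2 (Finset.mem_filter.2 ⟨Finset.mem_univ _, hfree a ha⟩)) (fun a _ b _ h => h)
  have hopt : (G.toHouse i j).val φ ≤ (G.toHouse i j).opt :=
    Finset.le_sup (f := (G.toHouse i j).val) (Finset.mem_univ φ)
  omega

/-! ### The biclique obtained from an edge and an assignment -/

section Biclique

variable (φ : (G.toHouse i₀ j₀).Assignment)

open Classical in
/-- The left side of the biclique obtained from an edge and an assignment. -/
noncomputable def leftSide : Finset (Fin G.N) :=
  Finset.univ.filter fun a => a.val = i₀ ∨ LeftHalf G.N G.M (Held φ) (G.AdjAvoid i₀ j₀) a.val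

open Classical in
/-- The right side of the biclique obtained from an edge and an assignment. -/
noncomputable def rightSide : Finset (Fin G.M) :=
  Finset.univ.filter fun c => c.val = j₀ ∨ RightHalf G.N G.M (Held φ) (G.AdjAvoid i₀ j₀) c.val

variable {φ}

/-- `AdjAvoid` excludes `i₀`, while a member of the left half is related to some house. Hence adding
the edge really enlarges the side by one. -/
theorem not_leftHalf (hi : i₀ < G.N) :
    ¬LeftHalf G.N G.M (Held φ) (G.AdjAvoid i₀ j₀) i₀ := fun h =>
  let ⟨_, hc⟩ := h.exists_rightHalf hi
  (h.rel hc).2.2.2.1 rfl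

theorem not_rightHalf : ¬RightHalf G.N G.M (Held φ) (G.AdjAvoid i₀ j₀) j₀ := fun h =>
  let ⟨_, _, ha⟩ := h.exists_leftHalf
  (ha.rel h).2.2.2.2 rfl

theorem card_leftSide (h₀ : G.Adj i₀ j₀) :
    (leftSide φ).card = goodCount G.N G.M (Held φ) (G.AdjAvoid i₀ j₀) / 2 + 1 := by
  classical
  have hi : i₀ < G.N := h₀.1
  rw [← card_leftHalf (R := Held φ) (fun _ _ _ => Held.right_unique)
      (fun _ _ _ => Held.left_unique),
    ← Finset.card_insert_of_notMem (a := i₀) (by simp [not_leftHalf hi]), leftSide,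
    Fin.card_filter_val (fun a => a = i₀ ∨ LeftHalf G.N G.M (Held φ) (G.AdjAvoid i₀ j₀) a)]
  congr 1
  ext a
  simp only [Finset.mem_filter, Finset.mem_range, Finset.mem_insert]
  constructor
  · rintro ⟨h, rfl | h'⟩
    exacts [.inl rfl, .inr ⟨h, h'⟩]
  · rintro (rfl | h)
    exacts [⟨hi, .inl rfl⟩, ⟨h.1, .inr h.2⟩]

theorem card_rightSide (h₀ : G.Adj i₀ j₀) :
    (rightSide φ).card = goodCount G.N G.M (Held φ) (G.AdjAvoid i₀ j₀) / 2 + 1 := by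
  classical
  have hj : j₀ < G.M := h₀.2.1
  rw [← card_rightHalf,
    ← Finset.card_insert_of_notMem (a := j₀) (by simp [not_rightHalf]), rightSide,
    Fin.card_filter_val (fun c => c = j₀ ∨ RightHalf G.N G.M (Held φ) (G.AdjAvoid i₀ j₀) c)]
  congr 1
  ext a
  simp only [Finset.mem_filter, Finset.mem_range, Finset.mem_insert]
  constructor
  · rintro ⟨h, rfl | h'⟩
    exacts [.inl rfl, .inr ⟨h, h'⟩]
  · rintro (rfl | h)
    exacts [⟨hj, .inl rfl⟩, ⟨h.1, .inr h.2⟩]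

theorem mem_leftSide {b : Fin G.N} : b ∈ leftSide φ ↔
    b.val = i₀ ∨ LeftHalf G.N G.M (Held φ) (G.AdjAvoid i₀ j₀) b.val := by
  classical
  simp [leftSide]

theorem mem_rightSide {c : Fin G.M} : c ∈ rightSide φ ↔
    c.val = j₀ ∨ RightHalf G.N G.M (Held φ) (G.AdjAvoid i₀ j₀) c.val := by
  classical
  simp [rightSide]

/-- Pairs from the two halves are adjacent by `LeftHalf.rel`. For a pair containing one end of the
edge, a partner from the opposite half shows that the other vertex is a neighbour of that end. -/
theorem isBalancedBiclique_sides (h₀ : G.Adj i₀ j₀) :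
    G.IsBalancedBiclique (leftSide φ) (rightSide φ) := by
  refine ⟨(card_leftSide h₀).trans (card_rightSide h₀).symm, fun b hb c hc => ?_⟩
  have key : G.Adj b c := by
    rcases mem_leftSide.1 hb with hb | hb <;> rcases mem_rightSide.1 hc with hc | hc
    · rw [hb, hc]; exact h₀
    · obtain ⟨a, _, ha⟩ := hc.exists_leftHalf
      rw [hb]; exact (ha.rel hc).2.2.1
    · obtain ⟨d, hd⟩ := hb.exists_rightHalf b.isLt
      rw [hc]; exact (hb.rel hd).2.1
    · exact (hb.rel hc).1
  exact key.2.2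

end Biclique

end BipartiteInstance

/-! ### The reduction in polynomial time -/

theorem encodeNNRat_natCast (k : ℕ) :
    encodeNNRat (k : ℚ≥0) = encodeBinary k ++ [tick, Γ'.comma] := by
  simp [encodeNNRat, encodeBinary]

/-- The exponentially large utilities are powers of two, so their binary encodings are short and can
be written without arithmetic. -/
theorem encodeBinary_two_pow (k : ℕ) :
    encodeBinary (2 ^ k) = List.replicate k (Γ'.bit false) ++ [tick, Γ'.comma] := by
  have h : (2 ^ k : ℕ).bits = List.replicate k false ++ [true] := by
    induction k with
    | zero => simp
    | succ k ih => rw [pow_succ', Nat.bit0_bits _ (by positivity), ih]; rfl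
  simp [encodeBinary, h]

namespace BipartiteInstance

open Classical in
theorem encodeNNRat_houseValue (G : BipartiteInstance) (i₀ j₀ a h : ℕ) :
    encodeNNRat (G.houseValue i₀ j₀ a h) = if G.M ≤ h then [Γ'.comma, tick, Γ'.comma]
      else if G.AdjAvoid i₀ j₀ a h then [tick, Γ'.comma, tick, Γ'.comma]
      else List.replicate (h + 1) (Γ'.bit false) ++ [tick, Γ'.comma, tick, Γ'.comma] := by
  by_cases hh : G.M ≤ h
  · rw [houseValue_of_le hh, if_pos hh]
    simpa [encodeBinary] using encodeNNRat_natCast 0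
  · rw [if_neg hh]
    by_cases ha : G.AdjAvoid i₀ j₀ a h
    · rw [houseValue_of_adj (not_le.1 hh) ha, if_pos ha]
      simpa [encodeBinary] using encodeNNRat_natCast 1
    · rw [houseValue_of_not_adj (not_le.1 hh) ha, if_neg ha]
      have := encodeNNRat_natCast (2 ^ (h + 1))
      rw [encodeBinary_two_pow] at this
      simpa using this

theorem encode_toHouse (G : BipartiteInstance) (i₀ j₀ : ℕ) :
    (G.toHouse i₀ j₀).encode = encodeUnary G.N ++ encodeUnary (G.M - 1 + G.N) ++
      (List.range G.N).flatMap fun a => ((List.range (G.M - 1 + G.N)).flatMap fun h =>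
        encodeNNRat (G.houseValue i₀ j₀ a h)) ++ [Γ'.ket] := by
  rw [← flatMap_finRange]
  simp only [← flatMap_finRange]
  rfl

end BipartiteInstance

/-- Agents and houses are listed in unary in the instance, so its length bounds both dimensions of
the `0/1`-matrix. -/
theorem length_encodeAssignment_le (I : HouseInstance) (φ : I.Assignment) :
    (I.encodeAssignment φ).length ≤
      (Polynomial.X * (Polynomial.X + 1) : Polynomial ℕ).eval I.encode.length := by
  have h : I.n ≤ I.encode.length ∧ I.m ≤ I.encode.length := by
    simp only [HouseInstance.encode, encodeUnary, List.length_append, List.length_replicate]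
    omega
  rw [HouseInstance.encodeAssignment, length_encodeTable_singleton]
  simp only [Polynomial.eval_mul, Polynomial.eval_add, Polynomial.eval_X, Polynomial.eval_one]
  exact Nat.mul_le_mul h.1 (Nat.succ_le_succ h.2)

section Reduction

variable {alg : (I : HouseInstance) → I.Assignment} {X : Type} {C : RegContext X}
  {G : X → BipartiteInstance} {i j a c : X → ℕ}

section Graph

variable {tm : FinTM2}

theorem PolyPred.adjAvoid (hG : PolyTime tm C fun x => (G x).encode) (hi : PolyNat tm C i)
    (hj : PolyNat tm C j) (ha : PolyNat tm C a) (hc : PolyNat tm C c) :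
    PolyPred tm C fun x => (G x).AdjAvoid (i x) (j x) (a x) (c x) :=
  (PolyPred.adj hG ha hc).and ((PolyPred.adj hG ha hj).and ((PolyPred.adj hG hi hc).and
    ((PolyPred.eq ha hi).not.and (PolyPred.eq hc hj).not)))

theorem PolyTime.unary (ha : PolyNat tm C a) : PolyTime tm C fun x => encodeUnary (a x) :=
  PolyTime.append ha (.symbol Γ'.comma)

theorem PolyTime.encode_toHouse (hG : PolyTime tm C fun x => (G x).encode) (hi : PolyNat tm C i)
    (hj : PolyNat tm C j) : PolyTime tm C fun x => ((G x).toHouse (i x) (j x)).encode := by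
  have hN := PolyNat.graphN hG
  have hM := PolyNat.graphM hG
  have hm := hM.pred.add hN
  refine ((PolyTime.unary hN).append (PolyTime.unary hm) |>.append
    (PolyTime.flatMapRange hN ((PolyTime.flatMapRange hm.weaken
      (PolyTime.ite (PolyPred.le hM.weaken.weaken .index) (.word [Γ'.comma, tick, Γ'.comma])
      (PolyTime.ite (PolyPred.adjAvoid hG.weaken.weaken hi.weaken.weaken hj.weaken.weaken
        PolyNat.index.weaken .index) (.word [tick, Γ'.comma, tick, Γ'.comma])
        ((PolyTime.replicate (PolyNat.index.add (.const 1)) (Γ'.bit false)).append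
          (.word [tick, Γ'.comma, tick, Γ'.comma]))))).append (.symbol Γ'.ket)))).congr fun x => ?_
  rw [BipartiteInstance.encode_toHouse]
  simp only [BipartiteInstance.encodeNNRat_houseValue]

end Graph

open BipartiteInstance

variable (h : TM2ComputableInPolyTime HouseInstance.encode (id : List Γ' → List Γ')
  fun I => I.encodeAssignment (alg I))

include h

/-- Each query rebuilds the house instance, runs the given algorithm on it and reads one cell of the
answer. The repeated runs agree because `alg` is a function. -/
theorem PolyPred.held (hG : PolyTime h.tm C fun x => (G x).encode) (hi : PolyNat h.tm C i)
    (hj : PolyNat h.tm C j) (ha : PolyNat h.tm C a) (hc : PolyNat h.tm C c) :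
    PolyPred h.tm C fun x => Held (alg ((G x).toHouse (i x) (j x))) (a x) (c x) := by
  have hN := PolyNat.graphN hG
  have hm := (PolyNat.graphM hG).pred.add hN
  have hout := PolyTime.oracle h (PolyTime.encode_toHouse hG hi hj)
    (fun I => length_encodeAssignment_le I (alg I))
  refine (((PolyPred.lt ha hN).and (PolyPred.lt hc hm)).and (PolyPred.getElem? hout
    ((ha.mul (hm.add (.const 1))).add hc) tick)).congr fun x => ?_
  set I := (G x).toHouse (i x) (j x) with hI
  have hget : ∀ (a : Fin I.n) (c : Fin I.m),
      (I.encodeAssignment (alg I))[a.val * (I.m + 1) + c.val]? =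
        some (Γ'.bit (decide (alg I a = c))) := fun a c =>
    getElem?_encodeTable_singleton (fun a c => Γ'.bit (decide (alg I a = c))) a c
  constructor
  · rintro ⟨ha, hac⟩
    have hcm : c x < I.m := hac ▸ (alg I ⟨a x, ha⟩).isLt
    refine ⟨⟨ha, hcm⟩, (hget ⟨a x, ha⟩ ⟨c x, hcm⟩).trans ?_⟩
    have : alg I ⟨a x, ha⟩ = ⟨c x, hcm⟩ := Fin.ext hac
    rw [decide_eq_true this]
  · rintro ⟨⟨ha, hcm⟩, hac⟩
    have h₁ := (hget ⟨a x, ha⟩ ⟨c x, hcm⟩).symm.trans hac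
    have h₂ : alg I ⟨a x, ha⟩ = ⟨c x, hcm⟩ := by simpa using h₁
    exact ⟨ha, congrArg Fin.val h₂⟩

theorem PolyPred.good (hG : PolyTime h.tm C fun x => (G x).encode) (hi : PolyNat h.tm C i)
    (hj : PolyNat h.tm C j) (ha : PolyNat h.tm C a) (hc : PolyNat h.tm C c) :
    PolyPred h.tm C fun x => Good (G x).N (G x).M (Held (alg ((G x).toHouse (i x) (j x))))
      ((G x).AdjAvoid (i x) (j x)) (a x) (c x) := by
  have hN := PolyNat.graphN hG
  have hM := PolyNat.graphM hG
  exact (PolyPred.held h hG hi hj ha hc).and ((PolyPred.lt hc hM).and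
    (PolyPred.forall_lt hN (PolyPred.forall_lt hM.weaken
      (((PolyPred.lt hc.weaken.weaken .index).and (PolyPred.held h hG.weaken.weaken
        hi.weaken.weaken hj.weaken.weaken PolyNat.index.weaken .index)).imp
      (PolyPred.adjAvoid hG.weaken.weaken hi.weaken.weaken hj.weaken.weaken ha.weaken.weaken
        .index)))))

theorem PolyPred.goodHouse (hG : PolyTime h.tm C fun x => (G x).encode) (hi : PolyNat h.tm C i)
    (hj : PolyNat h.tm C j) (hc : PolyNat h.tm C c) :
    PolyPred h.tm C fun x => GoodHouse (G x).N (G x).M (Held (alg ((G x).toHouse (i x) (j x))))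
      ((G x).AdjAvoid (i x) (j x)) (c x) :=
  PolyPred.exists_lt (PolyNat.graphN hG)
    (PolyPred.good h hG.weaken hi.weaken hj.weaken .index hc.weaken)

theorem PolyNat.goodCount (hG : PolyTime h.tm C fun x => (G x).encode) (hi : PolyNat h.tm C i)
    (hj : PolyNat h.tm C j) :
    PolyNat h.tm C fun x => _root_.goodCount (G x).N (G x).M
      (Held (alg ((G x).toHouse (i x) (j x)))) ((G x).AdjAvoid (i x) (j x)) := by
  classical
  refine (PolyNat.card (PolyNat.graphM hG)
    (PolyPred.goodHouse h hG.weaken hi.weaken hj.weaken .index)).congr fun x => ?_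
  unfold _root_.goodCount
  congr!

theorem PolyNat.lowerRank (hG : PolyTime h.tm C fun x => (G x).encode) (hi : PolyNat h.tm C i)
    (hj : PolyNat h.tm C j) (hc : PolyNat h.tm C c) :
    PolyNat h.tm C fun x => _root_.lowerRank (G x).N (G x).M
      (Held (alg ((G x).toHouse (i x) (j x)))) ((G x).AdjAvoid (i x) (j x)) (c x) := by
  classical
  refine (PolyNat.card (PolyNat.graphM hG)
    ((PolyPred.goodHouse h hG.weaken hi.weaken hj.weaken .index).and
      (PolyPred.le .index hc.weaken))).congr fun x => ?_
  unfold _root_.lowerRank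
  congr!

theorem PolyNat.upperRank (hG : PolyTime h.tm C fun x => (G x).encode) (hi : PolyNat h.tm C i)
    (hj : PolyNat h.tm C j) (hc : PolyNat h.tm C c) :
    PolyNat h.tm C fun x => _root_.upperRank (G x).N (G x).M
      (Held (alg ((G x).toHouse (i x) (j x)))) ((G x).AdjAvoid (i x) (j x)) (c x) := by
  classical
  refine (PolyNat.card (PolyNat.graphM hG)
    ((PolyPred.goodHouse h hG.weaken hi.weaken hj.weaken .index).and
      (PolyPred.le hc.weaken .index))).congr fun x => ?_
  unfold _root_.upperRank
  congr!

theorem PolyPred.leftHalf (hG : PolyTime h.tm C fun x => (G x).encode) (hi : PolyNat h.tm C i)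
    (hj : PolyNat h.tm C j) (ha : PolyNat h.tm C a) :
    PolyPred h.tm C fun x => LeftHalf (G x).N (G x).M (Held (alg ((G x).toHouse (i x) (j x))))
      ((G x).AdjAvoid (i x) (j x)) (a x) :=
  have hr := PolyNat.lowerRank h hG.weaken hi.weaken hj.weaken .index
  PolyPred.exists_lt (PolyNat.graphM hG)
    ((PolyPred.good h hG.weaken hi.weaken hj.weaken ha.weaken .index).and
      (PolyPred.le (hr.add hr) (PolyNat.goodCount h hG.weaken hi.weaken hj.weaken)))

theorem PolyPred.rightHalf (hG : PolyTime h.tm C fun x => (G x).encode) (hi : PolyNat h.tm C i)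
    (hj : PolyNat h.tm C j) (hc : PolyNat h.tm C c) :
    PolyPred h.tm C fun x => RightHalf (G x).N (G x).M (Held (alg ((G x).toHouse (i x) (j x))))
      ((G x).AdjAvoid (i x) (j x)) (c x) :=
  have hr := PolyNat.upperRank h hG hi hj hc
  (PolyPred.goodHouse h hG hi hj hc).and
    (PolyPred.le (hr.add hr) (PolyNat.goodCount h hG hi hj))

end Reduction

/-! ### The biclique of a best edge as a word -/

namespace BipartiteInstance

variable (alg : (I : HouseInstance) → I.Assignment) (G : BipartiteInstance)

open Classical in
/-- The word of the biclique obtained from the edge `(i₀, j₀)`. -/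
noncomputable def sidesWord (i₀ j₀ : ℕ) : List Γ' :=
  ((List.range G.N).flatMap fun a =>
      if a = i₀ ∨ LeftHalf G.N G.M (Held (alg (G.toHouse i₀ j₀))) (G.AdjAvoid i₀ j₀) a
      then [tick] else [Γ'.bit false]) ++ [Γ'.comma] ++
    (List.range G.M).flatMap fun c =>
      if c = j₀ ∨ RightHalf G.N G.M (Held (alg (G.toHouse i₀ j₀))) (G.AdjAvoid i₀ j₀) c
      then [tick] else [Γ'.bit false]

/-- The word of the empty biclique. -/
def emptyWord : List Γ' :=
  List.replicate G.N (Γ'.bit false) ++ [Γ'.comma] ++ List.replicate G.M (Γ'.bit false)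

/-- The edge `(i₀, j₀)` leads to as many good houses as any other edge. -/
def IsBestEdge (i₀ j₀ : ℕ) : Prop :=
  G.Adj i₀ j₀ ∧ ∀ i < G.N, ∀ j < G.M, G.Adj i j →
    goodCount G.N G.M (Held (alg (G.toHouse i j))) (G.AdjAvoid i j) ≤
      goodCount G.N G.M (Held (alg (G.toHouse i₀ j₀))) (G.AdjAvoid i₀ j₀)

open Classical in
/-- The words of the bicliques of all best edges and of the empty biclique, cut down to the
first one. -/
noncomputable def bestWord : List Γ' :=
  (((List.range G.N).flatMap fun i => (List.range G.M).flatMap fun j =>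
    if G.IsBestEdge alg i j then G.sidesWord alg i j else []) ++ G.emptyWord).take (G.N + 1 + G.M)

variable {alg}

theorem polyTime_bestWord (h : TM2ComputableInPolyTime HouseInstance.encode
    (id : List Γ' → List Γ') fun I => I.encodeAssignment (alg I)) :
    PolyTime h.tm (RegContext.base encode) fun G => G.bestWord alg := by
  have hG : PolyTime h.tm (RegContext.base encode) fun G => G.encode :=
    PolyTime.var (C := RegContext.base encode) (i := 0) Nat.one_pos
  have hN := PolyNat.graphN hG
  have hM := PolyNat.graphM hG
  have hi : PolyNat h.tm (RegContext.base encode).index.index fun p => p.1.2 :=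
    PolyNat.index.weaken
  have hj : PolyNat h.tm (RegContext.base encode).index.index fun p => p.2 := .index
  have hG' := hG.weaken.weaken
  have hbest : PolyPred h.tm (RegContext.base encode).index.index
      fun p => p.1.1.IsBestEdge alg p.1.2 p.2 :=
    (PolyPred.adj hG' hi hj).and (PolyPred.forall_lt hN.weaken.weaken
      (PolyPred.forall_lt hM.weaken.weaken.weaken
        ((PolyPred.adj hG'.weaken.weaken PolyNat.index.weaken .index).imp
          (PolyPred.le (PolyNat.goodCount h hG'.weaken.weaken PolyNat.index.weaken .index)
            (PolyNat.goodCount h hG' hi hj).weaken.weaken))))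
  have hword : PolyTime h.tm (RegContext.base encode).index.index
      fun p => p.1.1.sidesWord alg p.1.2 p.2 := by
    refine PolyTime.congr (((PolyTime.flatMapRange hN.weaken.weaken
      (PolyTime.ite ((PolyPred.eq .index hi.weaken).or (PolyPred.leftHalf h hG'.weaken hi.weaken
        hj.weaken .index)) (.symbol tick) (.symbol (Γ'.bit false)))).append
      (.symbol Γ'.comma)).append
    (PolyTime.flatMapRange hM.weaken.weaken
      (PolyTime.ite ((PolyPred.eq .index hj.weaken).or (PolyPred.rightHalf h hG'.weaken hi.weaken
        hj.weaken .index)) (.symbol tick) (.symbol (Γ'.bit false))))) fun p => ?_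
    unfold sidesWord
    congr!
  have hempty : PolyTime h.tm (RegContext.base encode) fun G => G.emptyWord :=
    ((PolyTime.replicate hN _).append (.symbol _)).append (PolyTime.replicate hM _)
  exact PolyTime.take ((PolyTime.flatMapRange hN (PolyTime.flatMapRange hM.weaken
    (PolyTime.ite hbest hword .nil))).append hempty) ((hN.add (.const 1)).add hM)

theorem flatMap_range_bit (n : ℕ) (P : ℕ → Prop) [DecidablePred P] :
    ((List.range n).flatMap fun a => if P a then [tick] else [Γ'.bit false]) =
      (List.finRange n).map fun a : Fin n => Γ'.bit (decide (P a.val)) := by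
  rw [← flatMap_finRange, List.map_eq_flatMap]
  congr 1
  funext a
  by_cases hP : P a.val <;> simp [hP]

theorem encodeBiclique_sides {i₀ j₀ : ℕ} (h₀ : G.Adj i₀ j₀) :
    G.encodeBiclique ⟨leftSide (alg (G.toHouse i₀ j₀)), rightSide (alg (G.toHouse i₀ j₀)),
      isBalancedBiclique_sides h₀⟩ = G.sidesWord alg i₀ j₀ := by
  classical
  unfold encodeBiclique sidesWord
  rw [flatMap_range_bit, flatMap_range_bit]
  simp only [mem_leftSide, mem_rightSide]

theorem encodeBiclique_empty :
    G.encodeBiclique ⟨∅, ∅, rfl, by simp⟩ = G.emptyWord := by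
  simp [encodeBiclique, emptyWord]

theorem length_encodeBiclique (B : G.BalancedBiclique) :
    (G.encodeBiclique B).length = G.N + 1 + G.M := by
  simp [encodeBiclique]
  omega

end BipartiteInstance

/-! ### The approximation guarantee -/

theorem List.flatMap_eq_nil_or_exists_prefix {α β : Type*} {P : List β → Prop} (l : List α)
    {w : α → List β} (h : ∀ a, w a = [] ∨ ∃ s, P s ∧ s <+: w a) :
    l.flatMap w = [] ∨ ∃ s, P s ∧ s <+: l.flatMap w := by
  induction l with
  | nil => exact .inl rfl
  | cons b l ih =>
    rw [List.flatMap_cons]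
    rcases h b with hb | ⟨s, hs, hb⟩
    · rwa [hb, List.nil_append]
    · exact .inr ⟨s, hs, hb.trans (List.prefix_append _ _)⟩

namespace BipartiteInstance

variable {G : BipartiteInstance} {alg : (I : HouseInstance) → I.Assignment}

theorem length_sidesWord {i₀ j₀ : ℕ} (h₀ : G.Adj i₀ j₀) :
    (G.sidesWord alg i₀ j₀).length = G.N + 1 + G.M := by
  rw [← encodeBiclique_sides G h₀, length_encodeBiclique]

theorem exists_isBestEdge {i j : ℕ} (h : G.Adj i j) : ∃ i₀ < G.N, ∃ j₀ < G.M,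
    G.IsBestEdge alg i₀ j₀ := by
  classical
  obtain ⟨⟨i₀, j₀⟩, hmem, hmax⟩ := Finset.exists_max_image
    ((Finset.range G.N ×ˢ Finset.range G.M).filter fun e => G.Adj e.1 e.2)
    (fun e => goodCount G.N G.M (Held (alg (G.toHouse e.1 e.2))) (G.AdjAvoid e.1 e.2))
    ⟨(i, j), by simpa using ⟨⟨h.1, h.2.1⟩, h⟩⟩
  simp only [Finset.mem_filter, Finset.mem_product, Finset.mem_range] at hmem
  refine ⟨i₀, hmem.1.1, j₀, hmem.1.2, hmem.2, fun i hi j hj hij => hmax (i, j) ?_⟩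
  simpa using ⟨⟨hi, hj⟩, hij⟩

/-- All the words listed have length `N + 1 + M`, so truncation selects the first one without any
search. It is that of the empty biclique only if no edge is best, that is, if there is no edge. -/
theorem bestWord_eq :
    (∃ i j, G.IsBestEdge alg i j ∧ G.bestWord alg = G.sidesWord alg i j) ∨
      (∀ i j, ¬G.Adj i j) ∧ G.bestWord alg = G.emptyWord := by
  classical
  have key := List.flatMap_eq_nil_or_exists_prefix
    (P := fun s => ∃ i j, G.IsBestEdge alg i j ∧ s = G.sidesWord alg i j) (List.range G.N)
    fun i => List.flatMap_eq_nil_or_exists_prefix (List.range G.M)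
      (w := fun j => if G.IsBestEdge alg i j then G.sidesWord alg i j else []) fun j => by
        by_cases h : G.IsBestEdge alg i j
        · exact .inr ⟨_, ⟨i, j, h, rfl⟩, by rw [if_pos h]⟩
        · exact .inl (if_neg h)
  rcases key with h | ⟨s, ⟨i, j, hij, rfl⟩, u, hu⟩
  · right
    constructor
    · intro i j hij
      obtain ⟨i₀, hi, j₀, hj, hbest⟩ := exists_isBestEdge (alg := alg) hij
      have h₁ := List.flatMap_eq_nil_iff.1 (List.flatMap_eq_nil_iff.1 h i₀ (List.mem_range.2 hi)) j₀
        (List.mem_range.2 hj)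
      rw [if_pos hbest] at h₁
      have h₂ := length_sidesWord (alg := alg) hbest.1
      rw [h₁, List.length_nil] at h₂
      omega
    · rw [bestWord, h, List.nil_append, List.take_of_length_le]
      rw [← encodeBiclique_empty, length_encodeBiclique]
  · refine .inl ⟨i, j, hij, ?_⟩
    rw [bestWord, ← hu, List.append_assoc, List.take_append_of_le_length, List.take_of_length_le]
    · exact (length_sidesWord hij.1).le
    · exact (length_sidesWord hij.1).ge

theorem opt_le {k : ℝ} (hk : 0 ≤ k) (h : ∀ S T, G.IsBalancedBiclique S T → ∀ i ∈ S, ∀ j ∈ T,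
    (S.card : ℝ) ≤ k) : (G.opt : ℝ) ≤ k := by
  rw [← Nat.le_floor_iff hk]
  refine Finset.sup_le fun B hB => ?_
  obtain ⟨S, T⟩ := B
  have hB : G.IsBalancedBiclique S T := (Finset.mem_filter.1 hB).2
  rcases S.eq_empty_or_nonempty with rfl | ⟨i, hi⟩
  · exact Nat.zero_le _
  · obtain ⟨j, hj⟩ : T.Nonempty := by
      rw [← Finset.card_pos, ← hB.1]
      exact Finset.card_pos.2 ⟨i, hi⟩
    exact Nat.le_floor (h S T hB i hi j hj)

end BipartiteInstance

/-- If all utilities vanish, every agent is envy-free in every assignment, and the guarantee reads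
`n ≤ f n * n`. -/
theorem one_le_of_opt_le {f : ℕ → ℝ} {alg : (I : HouseInstance) → I.Assignment}
    (h : ∀ I : HouseInstance, (I.opt : ℝ) ≤ f I.n * (I.val (alg I) : ℝ)) {n : ℕ} (hn : 0 < n) :
    1 ≤ f n := by
  let I : HouseInstance := ⟨n, n, le_rfl, fun _ _ => 0⟩
  have hval : ∀ φ : I.Assignment, I.val φ = n := fun φ => by
    have : (Finset.univ.filter (I.IsEnvyFree φ)) = Finset.univ :=
      Finset.filter_true_of_mem fun a _ b => le_rfl
    rw [HouseInstance.val, this]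
    exact Finset.card_fin n
  have hopt : n ≤ I.opt := (hval (alg I)).ge.trans (Finset.le_sup (f := I.val) (Finset.mem_univ _))
  have h₁ := h I
  rw [hval] at h₁
  have h₂ : (n : ℝ) ≤ I.opt := by exact_mod_cast hopt
  have h₃ : (0 : ℝ) < n := by exact_mod_cast hn
  exact le_of_mul_le_mul_right (by linarith [show I.n = n from rfl]) h₃

namespace BipartiteInstance

theorem exists_encodeBiclique_eq_bestWord {alg : (I : HouseInstance) → I.Assignment} {f : ℕ → ℝ}
    (h : ∀ I : HouseInstance, (I.opt : ℝ) ≤ f I.n * (I.val (alg I) : ℝ)) {ε : ℝ} (hε : 0 < ε)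
    (G : BipartiteInstance) : ∃ B : G.BalancedBiclique, G.encodeBiclique B = G.bestWord alg ∧
      (G.opt : ℝ) ≤ 2 * (1 + ε) * f G.N * (B.S.card : ℝ) := by
  rcases bestWord_eq (G := G) (alg := alg) with ⟨i₀, j₀, hbest, hw⟩ | ⟨hno, hw⟩
  · refine ⟨_, (encodeBiclique_sides G hbest.1).trans hw.symm, ?_⟩
    have hf : 1 ≤ f G.N := one_le_of_opt_le h (Nat.zero_lt_of_lt hbest.1.1)
    rw [card_leftSide hbest.1]
    set k := goodCount G.N G.M (Held (alg (G.toHouse i₀ j₀))) (G.AdjAvoid i₀ j₀)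
    refine opt_le (by positivity) fun S T hST i hi j hj => ?_
    have hadj : G.Adj i j := ⟨i.isLt, j.isLt, hST.2 i hi j hj⟩
    have h₁ : (S.card : ℝ) ≤ (G.toHouse i j).opt + 1 := by exact_mod_cast le_opt_toHouse hST hi hj
    have h₂ : ((G.toHouse i j).val (alg (G.toHouse i j)) : ℝ) ≤ k := by
      -- The edge `(i, j)` comes from an arbitrary competing biclique; the count of the best edge
      -- dominates its count.
      exact_mod_cast (val_le_goodCount j.pos _).trans (hbest.2 i i.isLt j j.isLt hadj)
    have h₃ : ((G.toHouse i j).opt : ℝ) ≤ f G.N * k :=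
      (h (G.toHouse i j)).trans (mul_le_mul_of_nonneg_left h₂ (by positivity))
    -- The guessed edge contributes the summand `1` on the right, which makes up for both the
    -- rounding and the lost pair.
    have h₄ : (k + 1 : ℝ) ≤ 2 * ((k / 2 + 1 : ℕ) : ℝ) := by
      exact_mod_cast (by omega : k + 1 ≤ 2 * (k / 2 + 1))
    calc (S.card : ℝ) ≤ f G.N * (k + 1) := by linarith
      _ ≤ f G.N * (2 * ((k / 2 + 1 : ℕ) : ℝ)) := by gcongr
      -- The only place where `ε` enters: the bound already holds without the factor `1 + ε`.
      _ ≤ (1 + ε) * (f G.N * (2 * ((k / 2 + 1 : ℕ) : ℝ))) :=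
        le_mul_of_one_le_left (by positivity) (by linarith)
      _ = _ := by ring
  · refine ⟨_, (encodeBiclique_empty G).trans hw.symm, ?_⟩
    -- Without edges both sides are zero, whatever the value or sign of `f` is.
    simp only [Finset.card_empty, Nat.cast_zero, mul_zero]
    exact opt_le le_rfl fun S T hST i hi j hj =>
      absurd ⟨i.isLt, j.isLt, hST.2 i hi j hj⟩ (hno i j)

end BipartiteInstance

theorem theorem1 (ε : ℝ) (hε : 0 < ε) (f : ℕ → ℝ) (hf : HasPolyTimeEnvyFreeApprox f) :
    HasPolyTimeBicliqueApprox (fun N => 2 * (1 + ε) * f N) := by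
  obtain ⟨alg, ⟨h⟩, happ⟩ := hf
  choose algG hword hopt using
    BipartiteInstance.exists_encodeBiclique_eq_bestWord happ hε
  refine ⟨algG, ?_, hopt⟩
  rw [funext hword]
  exact (BipartiteInstance.polyTime_bestWord h).toTM2
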